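/- A \emph{multi-graph} $G=(V,E)$ is finite and has no self-loops; parallel edges are allowed, $E_{u,w}$ is the set of edges joining $u$ and $w$, and $N_u$ is the set of neighbours of $u$. Its chromatic number is that of the underlying simple graph, and its girth is the length of a shortest simple cycle that does not use parallel edges ($\infty$ if there is none). Vertices are agents and edges are goods. Agent $u$ has a valuation $v_u:2^E\to\mathbb Z_{\ge 0}$ with $v_u(S\cup\{g\})=v_u(S)$ for all $S\subseteq E$ whenever $g$ is not incident to $u$. A valuation $v$ is \emph{cancellable} if $v(S\cup\{g\})\ge v(S)$ for all $S,g$, and $v(S)\ge v(T)$ implies $v(S\cup\{g\})\ge v(T\cup\{g\})$ for all $S,T$ and $g\notin S\cup T$. A complete allocation is a partition $(A_u)_{u\in V}$ of $E$ (bundles may be empty); it is \emph{EFX} if for all $u,w$ either $v_u(A_u)\ge v_u(A_w)$ or $v_u(A_u)\ge v_u(A_w\setminus\{x\})$ for all $x\in A_w$. \textbf{Algorithm $t$-Chromatic-EFX.} Input: $G$, a proper colouring $c:V\to\{1,\dots,t\}$, and valuations $(v_u)$. Start with $A_u=\emptyset$ for all $u$. For $i=1,\dots,t-1$, and for each vertex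 $u$ with $c(u)=i$ (in any order), let $N=\{w\in N_u: c(w)>i\}$; if $N=\emptyset$ do nothing, and otherwise do the following. (1) For each $w\in N$ take a partition of $E_{u,w}$ into two parts that is EFX for two identical agents with valuation $v_w$; let $S_w$ be a part of maximum $v_u$-value and $T_w$ a part of maximum $v_w$-value, with ties broken so that $S_w\ne T_w$ whenever $u$ or $w$ is indifferent between the two parts. (2) Choose $f\in N$ maximizing $v_u(S_f)$, and put $R=\bigcup_{w\in N\setminus\{f\}}(E_{u,w}\setminus T_w)$ and $\bar S=E_{u,f}\setminus S_f$. Replace $A_w$ by $A_w\cup T_w$ for every $w\in N\setminus\{f\}$. (3) If $S_f=T_f$ and $v_u(S_f)>v_u(A_u\cup\bar S\cup R)$, replace $A_f$ by $A_f\cup A_u\cup\bar S\cup R$ and then $A_u$ by $S_f$. If $S_f=T_f$ and $v_u(S_f)\le v_u(A_u\cup\bar S\cup R)$, replace $A_u$ by $A_u\cup\bar S\cup R$ and $A_f$ by $A_f\cup S_f$. If $S_f\neq T_f$, replace $A_u$ by $A_u\cup S_f\cup R$ and $A_f$ by $A_f\cup T_f$. After the last phase, output $A$. \textbf{Theorem.}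 Let $G$ be a multi-graph with $n$ vertices, $m$ edges, chromatic number $t$ and girth at least $2t-1$, given together with a proper $t$-colouring, and let all valuations be cancellable. Then the algorithm can always be executed, and, whatever the choices left open (order of the vertices of one colour, EFX partitions in (1), ties), its output is a complete EFX allocation. Moreover, the algorithm runs in polynomial time: there are a single program for a random access machine (unit-cost addition, subtraction and comparison of natural numbers, and unit-cost queries to a value oracle that returns $v_u(S)$ for given $u$ and $S$) and a polynomial $p$ such that on every such input the program halts after at most $p(n+m)$ steps and returns an allocation that is an output of the algorithm (and hence a complete EFX allocation). -/

import Mathlib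

namespace ChromaticEFX

/-! ### Multi-graphs, valuations and allocations -/

/-- A multi-graph without self-loops: each edge has an unordered pair of distinct endpoints. -/
structure MultiGraph (V E : Type*) where
  /-- The endpoints of an edge. -/
  ends : E → Sym2 V
  /-- No edge joins a vertex to itself. -/
  loopless : ∀ e, ¬ (ends e).IsDiag

section Basic

variable {V E : Type*}

/-- The underlying simple graph (parallel edges identified). Its chromatic number is the chromatic
number of the multi-graph, and its extended girth (`⊤` for forests) is the length of a shortest
simple cycle of the multi-graph that does not use parallel edges. -/
def MultiGraph.simple (G : MultiGraph V E) : SimpleGraph V where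
  Adj u w := ∃ e, G.ends e = s(u, w)
  symm := ⟨fun _ _ ⟨e, he⟩ => ⟨e, he.trans Sym2.eq_swap⟩⟩
  loopless := ⟨fun u ⟨e, he⟩ => G.loopless e (by rw [he]; exact Sym2.mk_isDiag_iff.2 rfl)⟩

/-- A monotone cancellable valuation. -/
structure IsCancellable [DecidableEq E] (f : Finset E → ℕ) : Prop where
  monotone : ∀ (S : Finset E) (g : E), f S ≤ f (S ∪ {g})
  cancel : ∀ (S T : Finset E) (g : E), g ∉ S ∪ T → f T ≤ f S → f (T ∪ {g}) ≤ f (S ∪ {g})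

/-- Every agent has zero marginal value for every edge that is not incident to it. -/
def MultiGraph.Respects [DecidableEq E] (G : MultiGraph V E) (v : V → Finset E → ℕ) : Prop :=
  ∀ (u : V) (g : E), u ∉ G.ends g → ∀ S : Finset E, v u (S ∪ {g}) = v u S

/-- `A` is a (complete) allocation: the bundles partition the set of all edges. -/
structure IsAllocation (A : V → Finset E) : Prop where
  disjoint : ∀ u w : V, u ≠ w → Disjoint (A u) (A w)
  complete : ∀ e : E, ∃ u : V, e ∈ A u

/-- Envy-freeness up to any good. -/
def IsEFX [DecidableEq E] (v : V → Finset E → ℕ) (A : V → Finset E) : Prop :=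
  ∀ u w : V, v u (A w) ≤ v u (A u) ∨ ∀ x ∈ A w, v u (A w \ {x}) ≤ v u (A u)

end Basic

/-! ### The algorithm

The algorithm leaves open the order in which the vertices of a colour class are picked, the choice
of the cut among EFX cuts, and ties. It is therefore described as a relation between its input and
its possible outputs. -/

section Algorithm

variable {V E : Type*} [DecidableEq V] [DecidableEq E]

/-- `(P, Q)` is a partition of `B` that is EFX for two identical agents with valuation `f`. -/
structure IsCut (f : Finset E → ℕ) (B P Q : Finset E) : Prop where
  disjoint : Disjoint P Q
  union : P ∪ Q = B
  efx_left : f Q ≤ f P ∨ ∀ x ∈ Q, f (Q \ {x}) ≤ f P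
  efx_right : f P ≤ f Q ∨ ∀ x ∈ P, f (P \ {x}) ≤ f Q

/-- `S` is a bundle among `P`, `Q` of maximum value for `f`. -/
def IsPreferred (f : Finset E → ℕ) (P Q S : Finset E) : Prop :=
  (S = P ∨ S = Q) ∧ f P ≤ f S ∧ f Q ≤ f S

variable [Fintype V] [Fintype E]

/-- The set of parallel edges between `u` and `w`. -/
def MultiGraph.between (G : MultiGraph V E) (u w : V) : Finset E :=
  Finset.univ.filter fun e => G.ends e = s(u, w)

/-- The neighbours of `u` that lie to the right of `u`, that is, have a larger colour. -/
def MultiGraph.rightNbrs (G : MultiGraph V E) {t : ℕ} (c : V → Fin t) (u : V) : Finset V :=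
  Finset.univ.filter fun w => (∃ e, G.ends e = s(u, w)) ∧ c u < c w

/-- `S` and `T` arise when each right neighbour `w` of `u` cuts the edges between `u` and `w`:
`S w` is the part preferred by `u` and `T w` the part preferred by `w`. If `u` or `w` is
indifferent, ties are broken so that `S w ≠ T w`. -/
def CutAndPrefer (G : MultiGraph V E) {t : ℕ} (c : V → Fin t) (v : V → Finset E → ℕ) (u : V)
    (S T : V → Finset E) : Prop :=
  ∀ w ∈ G.rightNbrs c u, ∃ P Q : Finset E,
    IsCut (v w) (G.between u w) P Q ∧
    IsPreferred (v u) P Q (S w) ∧ IsPreferred (v w) P Q (T w) ∧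
    (v u P = v u Q ∨ v w P = v w Q → S w ≠ T w)

/-- The left-over goods of the ordinary (not favourite) right neighbours of `u`. -/
def leftOver (G : MultiGraph V E) {t : ℕ} (c : V → Fin t) (u f : V) (T : V → Finset E) :
    Finset E :=
  ((G.rightNbrs c u).erase f).biUnion fun w => G.between u w \ T w

/-- The allocation after the edges from `u` to its right neighbours have been assigned, where `f`
is the favourite neighbour of `u`. -/
def assign (G : MultiGraph V E) {t : ℕ} (c : V → Fin t) (v : V → Finset E → ℕ) (u f : V)
    (S T : V → Finset E) (A : V → Finset E) : V → Finset E :=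
  let rest := leftOver G c u f T
  let coS := G.between u f \ S f
  let newU :=
    if S f = T f then
      if v u (A u ∪ coS ∪ rest) < v u (S f) then S f else A u ∪ coS ∪ rest
    else A u ∪ S f ∪ rest
  let newF :=
    if S f = T f then
      if v u (A u ∪ coS ∪ rest) < v u (S f) then A f ∪ A u ∪ coS ∪ rest else A f ∪ S f
    else A f ∪ T f
  fun w =>
    if w = u then newU
    else if w = f then newF
    else if w ∈ G.rightNbrs c u then A w ∪ T w
    else A w

/-- One iteration of the inner loop: the vertex `u` is resolved, and the allocation `A` becomes
`A'`. Nothing happens if `u` has no right neighbours. -/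
def Resolves (G : MultiGraph V E) {t : ℕ} (c : V → Fin t) (v : V → Finset E → ℕ) (u : V)
    (A A' : V → Finset E) : Prop :=
  (G.rightNbrs c u = ∅ ∧ A' = A) ∨
  ∃ (S T : V → Finset E) (f : V),
    CutAndPrefer G c v u S T ∧
    f ∈ G.rightNbrs c u ∧ (∀ w ∈ G.rightNbrs c u, v u (S w) ≤ v u (S f)) ∧
    A' = assign G c v u f S T A

/-- The vertices of a list are resolved one after the other. -/
def ResolvesList (G : MultiGraph V E) {t : ℕ} (c : V → Fin t) (v : V → Finset E → ℕ) :
    List V → (V → Finset E) → (V → Finset E) → Prop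
  | [], A, A' => A' = A
  | u :: l, A, A' => ∃ B, Resolves G c v u A B ∧ ResolvesList G c v l B A'

/-- The phase of colour `i`: all vertices of colour `i` are resolved, in some order. -/
def Phase (G : MultiGraph V E) {t : ℕ} (c : V → Fin t) (v : V → Finset E → ℕ) (i : ℕ)
    (A A' : V → Finset E) : Prop :=
  ∃ l : List V, l.Nodup ∧ (∀ u, u ∈ l ↔ (c u : ℕ) = i) ∧ ResolvesList G c v l A A'

/-- `A` is a possible output of the algorithm t-Chromatic-EFX: starting from empty bundles, there
is one phase for each colour except the last one. (Colours are numbered `0, …, t - 1`.) -/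
def IsOutput (G : MultiGraph V E) {t : ℕ} (c : V → Fin t) (v : V → Finset E → ℕ)
    (A : V → Finset E) : Prop :=
  ∃ B : ℕ → V → Finset E, (B 0 = fun _ => ∅) ∧
    (∀ i, i < t - 1 → Phase G c v i (B i) (B (i + 1))) ∧ B (t - 1) = A

end Algorithm

/-! ### The machine model

Programs act on a random access memory that holds natural numbers and is divided into numbered
variables and numbered arrays. The only arithmetic operations are addition and truncated
subtraction, so that unit cost is, up to a polynomial, the cost on a Turing machine. Valuations are
available through a value oracle. All loops are counting loops, so that every program halts; the
number of steps is counted while the program runs. -/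

/-- A memory state. -/
structure Mem where
  /-- The contents of the variables. -/
  var : ℕ → ℕ
  /-- The contents of the arrays: `arr a i` is cell `i` of array `a`. -/
  arr : ℕ → ℕ → ℕ

/-- Overwrite a variable. -/
def Mem.setVar (σ : Mem) (x k : ℕ) : Mem :=
  { σ with var := Function.update σ.var x k }

/-- Overwrite an array cell. -/
def Mem.setArr (σ : Mem) (a i k : ℕ) : Mem :=
  { σ with arr := Function.update σ.arr a (Function.update (σ.arr a) i k) }

/-- Arithmetic expressions. -/
inductive Expr where
  | const (k : ℕ)
  | var (x : ℕ)
  | read (a : ℕ) (i : Expr)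
  | add (e₁ e₂ : Expr)
  | sub (e₁ e₂ : Expr)

/-- The value of an expression. -/
def Expr.eval (σ : Mem) : Expr → ℕ
  | .const k => k
  | .var x => σ.var x
  | .read a i => σ.arr a (i.eval σ)
  | .add e₁ e₂ => e₁.eval σ + e₂.eval σ
  | .sub e₁ e₂ => e₁.eval σ - e₂.eval σ

/-- The number of steps needed to evaluate an expression. -/
def Expr.size : Expr → ℕ
  | .const _ => 1
  | .var _ => 1
  | .read _ i => i.size + 1
  | .add e₁ e₂ => e₁.size + e₂.size + 1
  | .sub e₁ e₂ => e₁.size + e₂.size + 1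

/-- Programs. `query x e a` asks the oracle for the value that the agent with number `e` assigns to
the bundle whose indicator is array `a`, and stores the answer in variable `x`. `loop x e c`
evaluates `e` once and runs `c` for `x = 0, 1, …, e - 1`. -/
inductive Prog where
  | skip
  | setVar (x : ℕ) (e : Expr)
  | setArr (a : ℕ) (i e : Expr)
  | query (x : ℕ) (e : Expr) (a : ℕ)
  | seq (c₁ c₂ : Prog)
  | ifLe (e₁ e₂ : Expr) (c₁ c₂ : Prog)
  | loop (x : ℕ) (e : Expr) (c : Prog)

/-- The memory after `k` rounds of a loop with the given round function. -/
def rounds (body : ℕ → Mem → Mem) (σ : Mem) : ℕ → Mem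
  | 0 => σ
  | k + 1 => body k (rounds body σ k)

/-- The memory after a program has been run. The oracle `O` receives the number of an agent and the
contents of an array. -/
def Prog.run (O : ℕ → (ℕ → ℕ) → ℕ) : Prog → Mem → Mem
  | .skip, σ => σ
  | .setVar x e, σ => σ.setVar x (e.eval σ)
  | .setArr a i e, σ => σ.setArr a (i.eval σ) (e.eval σ)
  | .query x e a, σ => σ.setVar x (O (e.eval σ) (σ.arr a))
  | .seq c₁ c₂, σ => c₂.run O (c₁.run O σ)
  | .ifLe e₁ e₂ c₁ c₂, σ => if e₁.eval σ ≤ e₂.eval σ then c₁.run O σ else c₂.run O σ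
  | .loop x e c, σ => rounds (fun i τ => c.run O (τ.setVar x i)) σ (e.eval σ)

/-- The number of steps of a program. -/
def Prog.time (O : ℕ → (ℕ → ℕ) → ℕ) : Prog → Mem → ℕ
  | .skip, _ => 1
  | .setVar _ e, _ => 1 + e.size
  | .setArr _ i e, _ => 1 + i.size + e.size
  | .query _ e _, _ => 1 + e.size
  | .seq c₁ c₂, σ => c₁.time O σ + c₂.time O (c₁.run O σ)
  | .ifLe e₁ e₂ c₁ c₂, σ =>
      1 + e₁.size + e₂.size + if e₁.eval σ ≤ e₂.eval σ then c₁.time O σ else c₂.time O σ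
  | .loop x e c, σ =>
      1 + e.size + ∑ i ∈ Finset.range (e.eval σ),
        (1 + c.time O ((rounds (fun j τ => c.run O (τ.setVar x j)) σ i).setVar x i))

/-- The value oracle of a profile of valuations; a bundle is given by an array whose nonzero cells
are its elements. -/
def valueOracle {n m : ℕ} (v : Fin n → Finset (Fin m) → ℕ) (u : ℕ) (a : ℕ → ℕ) : ℕ :=
  if h : u < n then v ⟨u, h⟩ (Finset.univ.filter fun e : Fin m => a e ≠ 0) else 0

/-- The memory holds the input: variables `0`, `1`, `2` hold the numbers of vertices, of edges and
of colours, arrays `0` and `1` hold the two endpoints of each edge (in either order), and array `2`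
holds the colour of each vertex. The rest of the memory is arbitrary. -/
structure HoldsInput {n m t : ℕ} (G : MultiGraph (Fin n) (Fin m)) (c : Fin n → Fin t) (σ : Mem) :
    Prop where
  numVertices : σ.var 0 = n
  numEdges : σ.var 1 = m
  numColours : σ.var 2 = t
  endpoints : ∀ e : Fin m, ∃ u w : Fin n,
    G.ends e = s(u, w) ∧ σ.arr 0 e = u ∧ σ.arr 1 e = w
  colours : ∀ u : Fin n, σ.arr 2 u = c u

/-- The memory holds an allocation as output: array `3` holds, for each edge, its owner. -/
def HoldsOutput {n m : ℕ} (A : Fin n → Finset (Fin m)) (σ : Mem) : Prop :=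
  ∀ e : Fin m, ∃ u : Fin n, σ.arr 3 e = u ∧ ∀ w : Fin n, e ∈ A w ↔ w = u

end ChromaticEFX

namespace ChromaticEFX

set_option linter.unusedSectionVars false

/-! ### Short cycles from distinct paths -/

/-! Orient every edge towards its endpoint of larger colour. Resolving `x` settles all edges leaving
`x` and has only two outcomes. Either each right neighbour `w` keeps `T w` and `x` adds the other
parts to its bundle (`keepAlloc`), or `x` ends with `T f` alone, while its old bundle and those
other parts move on to the favourite `f` (`dumpAlloc`). No agent's value for its own bundle ever
drops (`IsStep.le`), so a bound by that value stays true once it holds.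

Fix agents `u` and `w`. Only the goods at `u` matter to `u` in `A w`, and each of them falls into
one of three cases. (a) It left in the direction of a right neighbour `z` when `u` was resolved or
was dumped; the goods of one direction `z` are together worth at most `A u`, since `u` obtained a
part at least as good as every `T z`, and dumps only for something at least as good as what it gives
up. (b) `u` conceded it to a left neighbour; each time `u` took its preferred part, and
cancellability adds up these comparisons, so all concessions together are worth at most `A u`. (c)
`w` holds exactly the part `T u` of a cut made by `u`, whose other part went to `u`; then the EFX
property of the cut suffices, and the bundle of a resolved agent never changes again.

The bounds in (a) and (b) are of no use if `A w` mixes goods of several directions, or of both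
kinds. This is where the girth enters. A good of kind (a) or (b) travels from `u` to a neighbour
`z`, and then by dumps along strictly increasing colours, which gives a short path (`Route`). Two
such paths from `u` to `w` with different first steps, one of them to the right, would close a cycle
of length at most `2 * t - 2` (`Route.unique`). `IsInvariant` records the three cases,
`IsStep.isInvariant` preserves them, and `IsInvariant.isEFX` draws the conclusion.

For the running time, cuts are made greedily, placing goods by decreasing value into the poorer
part. Each run of the program is shown to be a run of the nondeterministic algorithm and so inherits
its correctness. The time bound is syntactic: every loop is bounded by one of the input sizes, and
there are at most as many colours as vertices. -/

theorem egirth_le_of_ne_paths {V : Type*} {G : SimpleGraph V} {u w : V}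
    {p q : G.Walk u w} (hp : p.IsPath) (hq : q.IsPath) (hne : p ≠ q) :
    G.egirth ≤ ((p.length + q.length : ℕ) : ℕ∞) := by
  classical
  -- In the graph formed by the edges of both paths, paths between given ends are not unique, so it
  -- has a cycle. The edges of a cycle are distinct, so its length is at most the number of edges
  -- available.
  let H : SimpleGraph V := SimpleGraph.fromEdgeSet {e | e ∈ p.edges ++ q.edges}
  have hpH : ∀ e ∈ p.edges, e ∈ H.edgeSet := fun e he => by
    have := G.not_isDiag_of_mem_edgeSet (p.edges_subset_edgeSet he)
    simp [H, he, this]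
  have hqH : ∀ e ∈ q.edges, e ∈ H.edgeSet := fun e he => by
    have := G.not_isDiag_of_mem_edgeSet (q.edges_subset_edgeSet he)
    simp [H, he, this]
  have hHG : H ≤ G := by
    intro a b hab
    have : s(a, b) ∈ p.edges ++ q.edges := ((SimpleGraph.fromEdgeSet_adj _).1 hab).1
    rcases List.mem_append.1 this with h | h
    · exact p.adj_of_mem_edges h
    · exact q.adj_of_mem_edges h
  have hcyc : ¬ H.IsAcyclic := fun hac => by
    have h := congrArg Subtype.val
      ((hac.subsingleton_path u w).elim ⟨p.transfer H hpH, hp.transfer hpH⟩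
        ⟨q.transfer H hqH, hq.transfer hqH⟩)
    apply hne
    apply SimpleGraph.Walk.ext_support
    have := congrArg SimpleGraph.Walk.support h
    simpa using this
  simp only [SimpleGraph.IsAcyclic, not_forall, not_not] at hcyc
  obtain ⟨a, w, hw⟩ := hcyc
  have h1 : G.egirth ≤ (w.mapLe hHG).length :=
    SimpleGraph.egirth_le_length (hw.mapLe hHG)
  refine h1.trans ?_
  have h2 : w.edges.toFinset ⊆ (p.edges ++ q.edges).toFinset := by
    intro e he
    have := w.edges_subset_edgeSet (List.mem_toFinset.1 he)
    simp only [H, SimpleGraph.edgeSet_fromEdgeSet] at this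
    exact List.mem_toFinset.2 this.1
  have h3 := Finset.card_le_card h2
  rw [List.toFinset_card_of_nodup hw.edges_nodup] at h3
  have h4 := h3.trans (List.toFinset_card_le _)
  simp only [List.length_append, SimpleGraph.Walk.length_edges] at h4
  simp only [SimpleGraph.Walk.mapLe, SimpleGraph.Walk.length_map]
  exact_mod_cast h4

/-! ### Cancellable valuations -/

section Valuation

variable {V E : Type*} [DecidableEq E] {f : Finset E → ℕ}

theorem IsCancellable.mono (h : IsCancellable f) {S T : Finset E} (hST : S ⊆ T) : f S ≤ f T := by
  have key : ∀ R : Finset E, f S ≤ f (S ∪ R) := by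
    intro R
    induction R using Finset.induction_on with
    | empty => simp
    | insert a R _ ih =>
      have e : S ∪ insert a R = (S ∪ R) ∪ {a} := by ext; simp
      rw [e]
      exact ih.trans (h.monotone _ _)
  have := key T
  rwa [Finset.union_eq_right.2 hST] at this

theorem IsCancellable.union_right_le (h : IsCancellable f) {S T : Finset E} (hle : f T ≤ f S)
    (R : Finset E) (hd : Disjoint R (S ∪ T)) : f (T ∪ R) ≤ f (S ∪ R) := by
  induction R using Finset.induction_on with
  | empty => simpa using hle
  | insert a R ha ih =>
    rw [Finset.disjoint_insert_left] at hd
    have e : ∀ X : Finset E, X ∪ insert a R = (X ∪ R) ∪ {a} := by intro X; ext; simp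
    rw [e, e]
    refine h.cancel _ _ _ ?_ (ih hd.2)
    simp only [Finset.mem_union] at hd ⊢
    tauto

/-- Replace `T₁` by `S₁` next to `T₂`, then `T₂` by `S₂` next to `S₁`. This substitute for
additivity is what lets an agent sum its comparisons over several cuts. -/
theorem IsCancellable.union_le_union (h : IsCancellable f) {S₁ T₁ S₂ T₂ : Finset E}
    (h₁ : f T₁ ≤ f S₁) (h₂ : f T₂ ≤ f S₂) (hd : Disjoint (S₁ ∪ T₁) (S₂ ∪ T₂)) :
    f (T₁ ∪ T₂) ≤ f (S₁ ∪ S₂) := by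
  have a : f (T₁ ∪ T₂) ≤ f (S₁ ∪ T₂) :=
    h.union_right_le h₁ _ (hd.symm.mono_left Finset.subset_union_right)
  have b : f (T₂ ∪ S₁) ≤ f (S₂ ∪ S₁) :=
    h.union_right_le h₂ _ (hd.mono_left Finset.subset_union_left)
  rw [Finset.union_comm T₂, Finset.union_comm S₂] at b
  exact a.trans b

/-- Goods not incident to `u` can be added to `T` free of charge, and then monotonicity applies.
Envy of `u` thus concerns only the goods at `u`. -/
theorem MultiGraph.Respects.le_of_incident {G : MultiGraph V E} {v : V → Finset E → ℕ}
    (hv : G.Respects v) {u : V} (h : IsCancellable (v u)) {S T : Finset E}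
    (hST : ∀ e ∈ S, u ∈ G.ends e → e ∈ T) : v u S ≤ v u T := by
  have key : ∀ R : Finset E, (∀ e ∈ R, u ∉ G.ends e) → v u (T ∪ R) = v u T := by
    intro R
    induction R using Finset.induction_on with
    | empty => simp
    | insert a R _ ih =>
      intro hR
      have e : T ∪ insert a R = (T ∪ R) ∪ {a} := by ext; simp
      rw [e, hv u a (hR a (by simp)), ih fun e he => hR e (by simp [he])]
  rw [← key (S \ T)]
  · exact h.mono (by simp)
  · intro e he hu
    rw [Finset.mem_sdiff] at he
    exact he.2 (hST e he.1 hu)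

/-! ### EFX cuts -/

theorem IsCut.symm {B P Q : Finset E} (h : IsCut f B P Q) : IsCut f B Q P :=
  ⟨h.disjoint.symm, by rw [Finset.union_comm, h.union], h.efx_right, h.efx_left⟩

/-- A good of least value is added to the poorer part of an EFX cut. -/
theorem IsCut.insert_left (hf : IsCancellable f) {B P Q : Finset E} (h : IsCut f B P Q) {g : E}
    (hg : g ∉ B) (hmin : ∀ x ∈ B, f {g} ≤ f {x}) (hle : f P ≤ f Q) :
    IsCut f (insert g B) (insert g P) Q := by
  have hPB : P ⊆ B := h.union ▸ Finset.subset_union_left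
  have hQB : Q ⊆ B := h.union ▸ Finset.subset_union_right
  have hP : f P ≤ f (insert g P) := hf.mono (Finset.subset_insert _ _)
  refine ⟨?_, ?_, ?_, Or.inr ?_⟩
  · exact Finset.disjoint_insert_left.2 ⟨fun hq => hg (hQB hq), h.disjoint⟩
  · rw [Finset.insert_union, h.union]
  · rcases h.efx_left with h1 | h1
    · exact Or.inl (h1.trans hP)
    · exact Or.inr fun x hx => (h1 x hx).trans hP
  · intro x hx
    rcases Finset.mem_insert.1 hx with rfl | hx
    · refine le_trans (hf.mono ?_) hle
      intro y hy
      simp only [Finset.mem_sdiff, Finset.mem_insert, Finset.mem_singleton] at hy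
      tauto
    · have hgP : g ∉ P := fun h => hg (hPB h)
      have hxg : x ≠ g := fun h => hgP (h ▸ hx)
      have e1 : insert g P \ {x} = {g} ∪ (P \ {x}) := by
        ext y
        simp only [Finset.mem_sdiff, Finset.mem_insert, Finset.mem_singleton, Finset.mem_union]
        constructor
        · tauto
        · rintro (rfl | hy)
          · exact ⟨Or.inl rfl, hxg.symm⟩
          · tauto
      have e2 : {x} ∪ (P \ {x}) = P := by
        ext y
        simp only [Finset.mem_sdiff, Finset.mem_singleton, Finset.mem_union]
        by_cases hyx : y = x
        · simp [hyx, hx]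
        · simp [hyx]
      -- Removing `x` from the enlarged part amounts to replacing `x` by the cheaper `g` in `P`, so
      -- at most the value of `P` remains.
      have h3 := hf.union_right_le (hmin x (hPB hx)) (P \ {x}) (by
        rw [Finset.disjoint_left]
        intro y hy
        simp only [Finset.mem_sdiff, Finset.mem_singleton, Finset.mem_union] at hy ⊢
        rintro (rfl | rfl)
        · exact hy.2 rfl
        · exact hgP hy.1)
      rw [e1]
      rw [e2] at h3
      exact h3.trans hle

theorem isCut_empty : IsCut f ∅ ∅ ∅ := ⟨by simp, by simp, by simp, by simp⟩

theorem exists_isCut (hf : IsCancellable f) (B : Finset E) : ∃ P Q, IsCut f B P Q := by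
  induction hn : B.card generalizing B with
  | zero =>
    rw [Finset.card_eq_zero] at hn
    subst hn
    exact ⟨∅, ∅, isCut_empty⟩
  | succ k ih =>
    obtain ⟨g, hg, hmin⟩ := Finset.exists_min_image B (fun x => f {x})
      (Finset.card_pos.1 (by omega))
    obtain ⟨P, Q, h⟩ := ih (B.erase g) (by rw [Finset.card_erase_of_mem hg]; omega)
    have hm : ∀ x ∈ B.erase g, f {g} ≤ f {x} := fun x hx => hmin x (Finset.mem_of_mem_erase hx)
    rw [← Finset.insert_erase hg]
    rcases le_total (f P) (f Q) with hle | hle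
    · exact ⟨_, _, h.insert_left hf (Finset.notMem_erase _ _) hm hle⟩
    · exact ⟨_, _, (h.symm.insert_left hf (Finset.notMem_erase _ _) hm hle).symm⟩

end Valuation

/-! ### The two outcomes of resolving a vertex -/

section Assign

variable {V E : Type*} [DecidableEq V] [DecidableEq E] [Fintype V] [Fintype E]
  {G : MultiGraph V E} {t : ℕ} {c : V → Fin t} {v : V → Finset E → ℕ} {u : V}
  {S T A : V → Finset E}

theorem MultiGraph.mem_between {u w : V} {e : E} : e ∈ G.between u w ↔ G.ends e = s(u, w) := by
  simp [MultiGraph.between]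

theorem MultiGraph.mem_rightNbrs {u w : V} :
    w ∈ G.rightNbrs c u ↔ (∃ e, G.ends e = s(u, w)) ∧ c u < c w := by
  simp [MultiGraph.rightNbrs]

/-- All goods at `u` that are cut off by the right neighbours of `u`. -/
def concession (G : MultiGraph V E) (c : V → Fin t) (u : V) (T : V → Finset E) : Finset E :=
  (G.rightNbrs c u).biUnion fun w => G.between u w \ T w

/-- Every right neighbour takes its preferred part, and `u` keeps the rest. -/
def keepAlloc (G : MultiGraph V E) (c : V → Fin t) (u : V) (T A : V → Finset E) : V → Finset E :=
  fun w =>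
    if w = u then A u ∪ concession G c u T
    else if w ∈ G.rightNbrs c u then A w ∪ T w
    else A w

/-- As `keepAlloc`, but then `u` and `f` exchange all they hold except the old bundle of `f`. -/
def dumpAlloc (G : MultiGraph V E) (c : V → Fin t) (u f : V) (T A : V → Finset E) :
    V → Finset E :=
  fun w =>
    if w = u then T f
    else if w = f then A f ∪ (A u ∪ concession G c u T)
    else if w ∈ G.rightNbrs c u then A w ∪ T w
    else A w

theorem IsCut.sdiff_left {g : Finset E → ℕ} {B P Q : Finset E} (h : IsCut g B P Q) : B \ P = Q := by
  rw [← h.union, Finset.union_sdiff_left]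
  exact Finset.sdiff_eq_self_of_disjoint h.disjoint.symm

theorem IsCut.sdiff_right {g : Finset E → ℕ} {B P Q : Finset E} (h : IsCut g B P Q) :
    B \ Q = P := h.symm.sdiff_left

theorem between_sdiff_union_leftOver {f : V} (hf : f ∈ G.rightNbrs c u) :
    (G.between u f \ T f) ∪ leftOver G c u f T = concession G c u T := by
  unfold leftOver concession
  conv_rhs => rw [← Finset.insert_erase hf]
  rw [Finset.biUnion_insert]

/-- This and the next two lemmas reduce the three cases of the algorithm to two outcomes. If `S f ≠
T f`, then `S f` is the part cut off by `f`, so `u` simply collects all concessions; the same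
happens if `S f = T f` but `u` does not prefer it. -/
theorem assign_of_dump {f : V} (hf : f ∈ G.rightNbrs c u) (h : S f = T f)
    (hlt : v u (A u ∪ concession G c u T) < v u (T f)) :
    assign G c v u f S T A = dumpAlloc G c u f T A := by
  have e := between_sdiff_union_leftOver (T := T) hf
  unfold assign dumpAlloc
  funext w
  simp only [h, if_true, Finset.union_assoc, e, hlt]

theorem assign_of_le {f : V} (hf : f ∈ G.rightNbrs c u) (h : S f = T f)
    (hle : v u (T f) ≤ v u (A u ∪ concession G c u T)) :
    assign G c v u f S T A = keepAlloc G c u T A := by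
  have e := between_sdiff_union_leftOver (T := T) hf
  unfold assign keepAlloc
  funext w
  simp only [h, if_true, Finset.union_assoc, e, not_lt.2 hle, if_false]
  by_cases hwf : w = f
  · subst hwf; simp [hf]
  · simp [hwf]

theorem assign_of_ne {f : V} (hcut : CutAndPrefer G c v u S T) (hf : f ∈ G.rightNbrs c u)
    (h : S f ≠ T f) : assign G c v u f S T A = keepAlloc G c u T A := by
  have e := between_sdiff_union_leftOver (T := T) hf
  obtain ⟨P, Q, hPQ, hS, hT, -⟩ := hcut f hf
  have hST : G.between u f \ T f = S f := by
    rcases hS.1 with hS | hS <;> rcases hT.1 with hT | hT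
    · exact absurd (hS.trans hT.symm) h
    · rw [hS, hT, hPQ.sdiff_right]
    · rw [hS, hT, hPQ.sdiff_left]
    · exact absurd (hS.trans hT.symm) h
  rw [hST] at e
  unfold assign keepAlloc
  funext w
  simp only [h, if_false, Finset.union_assoc, e]
  by_cases hwf : w = f
  · subst hwf; simp [hf]
  · simp [hwf]

/-- What the proof of correctness needs to know about one iteration. -/
theorem Resolves.cases {A' : V → Finset E} (hv : ∀ w, IsCancellable (v w))
    (h : Resolves G c v u A A') :
    (G.rightNbrs c u = ∅ ∧ A' = A) ∨
    ∃ (T : V → Finset E) (f : V), f ∈ G.rightNbrs c u ∧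
      (∀ w ∈ G.rightNbrs c u, T w ⊆ G.between u w ∧ v w (G.between u w \ T w) ≤ v w (T w) ∧
        v u (T w) ≤ v u (A' u)) ∧
      v u (A u) ≤ v u (A' u) ∧
      (A' = keepAlloc G c u T A ∨
        A' = dumpAlloc G c u f T A ∧ v u (A u ∪ concession G c u T) ≤ v u (T f) ∧
        (v f (T f) ≤ v f (G.between u f \ T f) ∨
          ∀ x ∈ T f, v f (T f \ {x}) ≤ v f (G.between u f \ T f))) := by
  refine h.imp id ?_
  rintro ⟨S, T, f, hcut, hf, hmax, rfl⟩
  have huu : u ∉ G.rightNbrs c u := fun h => lt_irrefl _ (MultiGraph.mem_rightNbrs.1 h).2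
  -- `T w` is one of the two parts, so `u` likes it no more than `S w`, and that no more than `S f`.
  have hT : ∀ w ∈ G.rightNbrs c u, T w ⊆ G.between u w ∧
      v w (G.between u w \ T w) ≤ v w (T w) ∧ v u (T w) ≤ v u (S f) := by
    intro w hw
    obtain ⟨P, Q, hPQ, hS, hT, -⟩ := hcut w hw
    have hPB : P ⊆ G.between u w := hPQ.union ▸ Finset.subset_union_left
    have hQB : Q ⊆ G.between u w := hPQ.union ▸ Finset.subset_union_right
    have hm := hmax w hw
    rcases hT.1 with h | h
    · refine ⟨h ▸ hPB, ?_, ?_⟩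
      · rw [h, hPQ.sdiff_left, ← h]; exact hT.2.2
      · rw [h]; exact hS.2.1.trans hm
    · refine ⟨h ▸ hQB, ?_, ?_⟩
      · rw [h, hPQ.sdiff_right, ← h]; exact hT.2.1
      · rw [h]; exact hS.2.2.trans hm
  suffices hmain : ∃ A', assign G c v u f S T A = A' ∧ v u (S f) ≤ v u (A' u) ∧
      v u (A u) ≤ v u (A' u) ∧
      (A' = keepAlloc G c u T A ∨
        A' = dumpAlloc G c u f T A ∧ v u (A u ∪ concession G c u T) ≤ v u (T f) ∧
        (v f (T f) ≤ v f (G.between u f \ T f) ∨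
          ∀ x ∈ T f, v f (T f \ {x}) ≤ v f (G.between u f \ T f))) by
    obtain ⟨A', rfl, h1, h2, h3⟩ := hmain
    exact ⟨T, f, hf, fun w hw => ⟨(hT w hw).1, (hT w hw).2.1, (hT w hw).2.2.trans h1⟩, h2, h3⟩
  have hku : keepAlloc G c u T A u = A u ∪ concession G c u T := by simp [keepAlloc]
  have hAu : v u (A u) ≤ v u (A u ∪ concession G c u T) := (hv u).mono Finset.subset_union_left
  by_cases hST : S f = T f
  · rcases lt_or_ge (v u (A u ∪ concession G c u T)) (v u (T f)) with hlt | hle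
    · have hdu : dumpAlloc G c u f T A u = T f := by simp [dumpAlloc]
      refine ⟨_, assign_of_dump hf hST hlt, by rw [hdu, hST], ?_, Or.inr ⟨rfl, hlt.le, ?_⟩⟩
      · rw [hdu]; exact hAu.trans hlt.le
      -- After a dump `f` holds the part complementary to `T f`, so the cut itself bounds the envy
      -- of `f` towards `u`.
      · obtain ⟨P, Q, hPQ, -, hT, -⟩ := hcut f hf
        rcases hT.1 with h | h
        · rw [h, hPQ.sdiff_left]; exact hPQ.efx_right
        · rw [h, hPQ.sdiff_right]; exact hPQ.efx_left
    · refine ⟨_, assign_of_le hf hST hle, ?_, ?_, Or.inl rfl⟩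
      · rw [hku, hST]; exact hle
      · rw [hku]; exact hAu
  · refine ⟨_, assign_of_ne hcut hf hST, ?_, ?_, Or.inl rfl⟩
    · rw [hku]
      refine (hv u).mono fun e he => Finset.mem_union_right _ ?_
      obtain ⟨P, Q, hPQ, hS, hT, -⟩ := hcut f hf
      refine Finset.mem_biUnion.2 ⟨f, hf, ?_⟩
      rcases hS.1 with hS | hS <;> rcases hT.1 with hT | hT
      · exact absurd (hS.trans hT.symm) hST
      · rwa [hT, hPQ.sdiff_right, ← hS]
      · rwa [hT, hPQ.sdiff_left, ← hS]
      · exact absurd (hS.trans hT.symm) hST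
    · rw [hku]; exact hAu

end Assign

/-! ### Routes of goods -/

section Route

variable {V E : Type*} {G : MultiGraph V E} {t : ℕ}

/-- There is a path from `u` to `w` with first step `z` which is short compared with the colours of
`z` and `w`, and which from `z` on uses colours up to that of `w` only. -/
def Route (G : MultiGraph V E) (c : V → Fin t) (u z w : V) : Prop :=
  ∃ (h : G.simple.Adj u z) (q : G.simple.Walk z w), (SimpleGraph.Walk.cons h q).IsPath ∧
    q.length + (c z : ℕ) ≤ c w ∧ ∀ s ∈ q.support, c s ≤ c w

theorem Route.of_adj {c : V → Fin t} {u z : V} (h : G.simple.Adj u z) : Route G c u z z :=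
  ⟨h, .nil, by simp [SimpleGraph.Walk.cons_isPath_iff, h.ne], by simp, by simp⟩

/-- A dump from `w` to `f` lengthens the path by one and raises the final colour by at least one, so
the length bound survives. The bound on colours along `q` shows that `f` is new there; only `u` may
have a larger colour, hence the separate assumption `u ≠ f`. -/
theorem Route.extend {c : V → Fin t} {u z w f : V} (h : Route G c u z w) (hwf : G.simple.Adj w f)
    (hc : c w < c f) (hfu : u ≠ f) : Route G c u z f := by
  obtain ⟨h, q, hp, hl, hs⟩ := h
  have hfq : f ∉ q.support := fun hf => absurd (hs f hf) (not_le.2 hc)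
  refine ⟨h, q.concat hwf, ?_, ?_, ?_⟩
  · rw [SimpleGraph.Walk.cons_isPath_iff] at hp ⊢
    refine ⟨hp.1.concat hfq hwf, ?_⟩
    rw [SimpleGraph.Walk.support_concat]
    simp [hp.2, hfu]
  · rw [SimpleGraph.Walk.length_concat]
    have : (c w : ℕ) < c f := hc
    omega
  · intro s hs'
    rw [SimpleGraph.Walk.support_concat] at hs'
    simp only [List.mem_append, List.mem_singleton] at hs'
    rcases hs' with h | rfl
    · exact (hs s h).trans hc.le
    · exact le_rfl

theorem Route.unique {c : G.simple.Coloring (Fin t)} {u w z z' : V}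
    (hg : ((2 * t - 1 : ℕ) : ℕ∞) ≤ G.simple.egirth) (h : Route G c u z w)
    (h' : Route G c u z' w) (hc : c u < c z) : z = z' := by
  obtain ⟨h, q, hp, hl, hs⟩ := h
  obtain ⟨h', q', hp', hl', hs'⟩ := h'
  by_contra hne
  have hne' : SimpleGraph.Walk.cons h q ≠ SimpleGraph.Walk.cons h' q' := fun he =>
    hne (by simpa using congrArg SimpleGraph.Walk.snd he)
  have := hg.trans (egirth_le_of_ne_paths hp hp' hne')
  have h1 : 2 * t - 1 ≤ (q.length + 1) + (q'.length + 1) := by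
    simpa only [SimpleGraph.Walk.length_cons, Nat.cast_le] using this
  -- The cycle has length at most `2 * c w - c z - c z' + 2`. From `c u < c z` and `c u ≠ c z'`
  -- follows `c z + c z' ≥ 2`: if `c z' = 0`, then `c u ≥ 1` and `c z ≥ 2`. With `c w ≤ t - 1` the
  -- length is at most `2 * t - 2`.
  have h2 : (c u : ℕ) ≠ c z' := fun he => c.valid h' (Fin.ext he)
  have h3 : (c u : ℕ) < c z := hc
  have h4 := (c w).isLt
  omega

end Route

/-! ### The invariant of the algorithm -/

section Invariant

variable {V E : Type*} [DecidableEq V] [DecidableEq E] [Fintype V] [Fintype E]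
  {G : MultiGraph V E} {t : ℕ} {v : V → Finset E → ℕ}

/-- The set `D` of vertices has been resolved. `Φ u z` contains the goods at `u` that left `u` or
were given away in the direction of its right neighbour `z`, and `R u` contains the goods at `u`
that `u` conceded to its left neighbours. -/
structure IsInvariant (G : MultiGraph V E) (c : V → Fin t) (v : V → Finset E → ℕ) (D : Set V)
    (A : V → Finset E) (Φ : V → V → Finset E) (R : V → Finset E) : Prop where
  disjoint : ∀ u w e, e ∈ A u → e ∈ A w → u = w
  owned : ∀ e, (∃ w, e ∈ A w) ↔ ∃ x ∈ D, ∃ z ∈ G.rightNbrs c x, e ∈ G.between x z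
  sent : ∀ u ∈ D, ∀ z ∈ G.rightNbrs c u, v u (Φ u z) ≤ v u (A u)
  conceded : ∀ u, v u (R u) ≤ v u (A u)
  left : ∀ u, ∀ e ∈ R u, ∃ y ∈ D, u ∈ G.rightNbrs c y ∧ e ∈ G.between y u
  routed : ∀ u w e, u ≠ w → e ∈ A w → u ∈ G.ends e →
    (u ∈ D ∧ ∃ z ∈ G.rightNbrs c u, Route G c u z w ∧ e ∈ Φ u z) ∨
    (∃ y, c y < c u ∧ Route G c u y w ∧ e ∈ R u) ∨
    (w ∈ D ∧ (v u (A w) ≤ v u (A u) ∨ ∀ x ∈ A w, v u (A w \ {x}) ≤ v u (A u)))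

theorem isInvariant_empty (G : MultiGraph V E) (c : V → Fin t) (v : V → Finset E → ℕ) :
    IsInvariant G c v ∅ (fun _ => ∅) (fun _ _ => ∅) (fun _ => ∅) :=
  ⟨by simp, by simp, by simp, by simp, by simp, by simp⟩

/-- Unless the EFX alternative holds outright, a single route through a right neighbour forces all
goods at `u` in `A w` into one set `Φ u z`; without such a route they all lie in `R u`. -/
theorem IsInvariant.isEFX {c : G.simple.Coloring (Fin t)} {D : Set V} {A R : V → Finset E}
    {Φ : V → V → Finset E} (h : IsInvariant G c v D A Φ R)
    (hg : ((2 * t - 1 : ℕ) : ℕ∞) ≤ G.simple.egirth) (hr : G.Respects v)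
    (hv : ∀ u, IsCancellable (v u)) : IsEFX v A := by
  intro u w
  rcases eq_or_ne u w with rfl | huw
  · exact Or.inl le_rfl
  by_cases hγ : w ∈ D ∧ (v u (A w) ≤ v u (A u) ∨ ∀ x ∈ A w, v u (A w \ {x}) ≤ v u (A u))
  · exact hγ.2
  by_cases hα : ∃ z ∈ G.rightNbrs c u, u ∈ D ∧ Route G c u z w
  · obtain ⟨z, hz, hu, hzw⟩ := hα
    refine Or.inl (le_trans (hr.le_of_incident (hv u) ?_) (h.sent u hu z hz))
    intro e he hue
    have hc := (MultiGraph.mem_rightNbrs.1 hz).2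
    rcases h.routed u w e huw he hue with ⟨-, z', hz', hr', he'⟩ | ⟨y, hy, hr', -⟩ | h'
    · rwa [hzw.unique hg hr' hc]
    · rw [← hzw.unique hg hr' hc] at hy
      exact absurd hc hy.asymm
    · exact absurd h' hγ
  · refine Or.inl (le_trans (hr.le_of_incident (hv u) ?_) (h.conceded u))
    intro e he hue
    rcases h.routed u w e huw he hue with ⟨hu, z', hz', hr', -⟩ | ⟨y, -, -, he'⟩ | h'
    · exact absurd ⟨z', hz', hu, hr'⟩ hα
    · exact he'
    · exact absurd h' hγ

/-- The colouring orients each edge, so an edge is handed out in the step of one vertex only and to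
one right neighbour only. -/
theorem rightEdge_unique {c : V → Fin t} {x z x' z' : V} {e : E} (hz : z ∈ G.rightNbrs c x)
    (he : e ∈ G.between x z) (hz' : z' ∈ G.rightNbrs c x') (he' : e ∈ G.between x' z') :
    x = x' ∧ z = z' := by
  rw [MultiGraph.mem_between] at he he'
  have h1 := (MultiGraph.mem_rightNbrs.1 hz).2
  have h2 := (MultiGraph.mem_rightNbrs.1 hz').2
  rw [he, Sym2.eq_iff] at he'
  rcases he' with h | ⟨rfl, rfl⟩
  · exact h
  · exact absurd h1 h2.asymm

theorem mem_keepAlloc {c : V → Fin t} {u w : V} {T A : V → Finset E}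
    (hT : ∀ w ∈ G.rightNbrs c u, T w ⊆ G.between u w) {e : E} :
    e ∈ keepAlloc G c u T A w ↔ e ∈ A w ∨ ∃ z ∈ G.rightNbrs c u, e ∈ G.between u z ∧
      ((e ∈ T z ∧ w = z) ∨ (e ∉ T z ∧ w = u)) := by
  have huu : u ∉ G.rightNbrs c u := fun h => lt_irrefl _ (MultiGraph.mem_rightNbrs.1 h).2
  unfold keepAlloc concession
  split_ifs with h1 h2
  · subst h1
    simp only [Finset.mem_union, Finset.mem_biUnion, Finset.mem_sdiff]
    grind
  · simp only [Finset.mem_union]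
    have : e ∈ T w → e ∈ G.between u w := fun h => hT w h2 h
    grind
  · grind

theorem mem_dumpAlloc {c : V → Fin t} {u f w : V} {T A : V → Finset E}
    (hf : f ∈ G.rightNbrs c u)
    (hT : ∀ w ∈ G.rightNbrs c u, T w ⊆ G.between u w) {e : E} :
    e ∈ dumpAlloc G c u f T A w ↔ (e ∈ A w ∧ w ≠ u) ∨ (w = f ∧ e ∈ A u) ∨
      ∃ z ∈ G.rightNbrs c u, e ∈ G.between u z ∧
        ((e ∈ T z ∧ z ≠ f ∧ w = z) ∨ (e ∈ T z ∧ z = f ∧ w = u) ∨ (e ∉ T z ∧ w = f)) := by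
  have huu : u ∉ G.rightNbrs c u := fun h => lt_irrefl _ (MultiGraph.mem_rightNbrs.1 h).2
  unfold dumpAlloc concession
  have hTf : e ∈ T f → e ∈ G.between u f := fun h => hT f hf h
  split_ifs with h1 h2 h3
  · subst h1
    grind
  · subst h2
    simp only [Finset.mem_union, Finset.mem_biUnion, Finset.mem_sdiff]
    grind
  · simp only [Finset.mem_union]
    have : e ∈ T w → e ∈ G.between u w := fun h => hT w h3 h
    grind
  · grind

end Invariant

/-! ### Preservation of the invariant, correctness of outputs, and existence of runs -/

section Step

variable {V E : Type*} [DecidableEq V] [DecidableEq E] [Fintype V] [Fintype E]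
  {G : MultiGraph V E} {t : ℕ} {v : V → Finset E → ℕ}

theorem IsInvariant.unowned {c : V → Fin t} {D : Set V} {A R : V → Finset E}
    {Φ : V → V → Finset E} (h : IsInvariant G c v D A Φ R) {x z : V} (hx : x ∉ D)
    (hz : z ∈ G.rightNbrs c x) {e : E} (he : e ∈ G.between x z) (w : V) : e ∉ A w := by
  intro hw
  obtain ⟨x', hx', z', hz', he'⟩ := (h.owned e).1 ⟨w, hw⟩
  exact hx ((rightEdge_unique hz he hz' he').1 ▸ hx')

/-- The description of one iteration, common to the cases of `keepAlloc` (`d` false) and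
`dumpAlloc` (`d` true). -/
structure IsStep (G : MultiGraph V E) (c : V → Fin t) (v : V → Finset E → ℕ) (x f : V) (d : Prop)
    (T A A' : V → Finset E) : Prop where
  fav : f ∈ G.rightNbrs c x
  sub : ∀ w ∈ G.rightNbrs c x, T w ⊆ G.between x w
  pref : ∀ w ∈ G.rightNbrs c x, v w (G.between x w \ T w) ≤ v w (T w)
  best : ∀ w ∈ G.rightNbrs c x, v x (T w) ≤ v x (A' x)
  mono : v x (A x) ≤ v x (A' x)
  dump : d → v x (A x ∪ concession G c x T) ≤ v x (A' x)
  efx : d → v f (T f) ≤ v f (G.between x f \ T f) ∨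
    ∀ y ∈ T f, v f (T f \ {y}) ≤ v f (G.between x f \ T f)
  mem : ∀ e w, e ∈ A' w ↔ (e ∈ A w ∧ (w = x → ¬ d)) ∨ (d ∧ w = f ∧ e ∈ A x) ∨
      ∃ z ∈ G.rightNbrs c x, e ∈ G.between x z ∧
        ((e ∈ T z ∧ ¬ (d ∧ z = f) ∧ w = z) ∨ (e ∈ T z ∧ d ∧ z = f ∧ w = x) ∨
          (e ∉ T z ∧ ¬ d ∧ w = x) ∨ (e ∉ T z ∧ d ∧ w = f))

theorem Resolves.isStep {c : V → Fin t} {x : V} {A A' : V → Finset E}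
    (hv : ∀ w, IsCancellable (v w)) (h : Resolves G c v x A A') :
    (G.rightNbrs c x = ∅ ∧ A' = A) ∨ ∃ f d T, IsStep G c v x f d T A A' := by
  refine (h.cases hv).imp id ?_
  rintro ⟨T, f, hf, hT, hm, rfl | ⟨rfl, hd, he⟩⟩
  · refine ⟨f, False, T, hf, fun w hw => (hT w hw).1, fun w hw => (hT w hw).2.1,
      fun w hw => (hT w hw).2.2, hm, False.elim, False.elim, fun e w => ?_⟩
    rw [mem_keepAlloc fun w hw => (hT w hw).1]
    simp
  · refine ⟨f, True, T, hf, fun w hw => (hT w hw).1, fun w hw => (hT w hw).2.1,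
      fun w hw => (hT w hw).2.2, hm, fun _ => ?_, fun _ => he, fun e w => ?_⟩
    · simpa [dumpAlloc] using hd
    · rw [mem_dumpAlloc hf fun w hw => (hT w hw).1]
      simp

theorem IsStep.superset {c : V → Fin t} {x f : V} {d : Prop} {T A A' : V → Finset E}
    (h : IsStep G c v x f d T A A') {w : V} (hw : w ≠ x) : A w ⊆ A' w := fun e he =>
  (h.mem e w).2 (Or.inl ⟨he, fun h => absurd h hw⟩)

theorem IsStep.le {c : V → Fin t} {x f : V} {d : Prop} {T A A' : V → Finset E}
    (hv : ∀ w, IsCancellable (v w)) (h : IsStep G c v x f d T A A') (w : V) :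
    v w (A w) ≤ v w (A' w) := by
  rcases eq_or_ne w x with rfl | hw
  · exact h.mono
  · exact (hv w).mono (h.superset hw)

/-- Vertices are resolved by nondecreasing colour, so the right neighbours of `x` are unresolved and
the edges towards them unowned. Goods that move follow a route extended by `f`; goods assigned now
start a route. -/
theorem IsStep.isInvariant {c : V → Fin t} {x f : V} {d : Prop} {T A A' : V → Finset E}
    {D : Set V} {Φ : V → V → Finset E} {R : V → Finset E} (hv : ∀ w, IsCancellable (v w))
    (h : IsInvariant G c v D A Φ R) (hx : x ∉ D) (hD : ∀ y ∈ D, c y ≤ c x)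
    (hs : IsStep G c v x f d T A A') :
    ∃ Φ' R', IsInvariant G c v (insert x D) A' Φ' R' := by
  classical
  have hun := fun z hz e he w => h.unowned (z := z) hx hz (e := e) he w
  have hN : ∀ z ∈ G.rightNbrs c x, z ∉ D ∧ z ≠ x := fun z hz => by
    have := (MultiGraph.mem_rightNbrs.1 hz).2
    exact ⟨fun hz => absurd this (not_lt.2 (hD z hz)), fun h => by simp [h] at this⟩
  have hadj : ∀ {u w e}, e ∈ G.between u w → G.simple.Adj u w := fun he =>
    ⟨_, MultiGraph.mem_between.1 he⟩
  have hfx := hN f hs.fav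
  have hcf := (MultiGraph.mem_rightNbrs.1 hs.fav).2
  have hxf : G.simple.Adj x f := (MultiGraph.mem_rightNbrs.1 hs.fav).1
  -- In a dump the direction of `f` carries the old bundle of `x` and all concessions instead of `T
  -- f`, which `x` holds.
  let Φ' : V → V → Finset E := fun u z =>
    if u = x then (if d ∧ z = f then A x ∪ concession G c x T else T z) else Φ u z
  -- In a dump `f` concedes nothing new, because the part it cut off comes back to it.
  let R' : V → Finset E := fun u =>
    if u ∈ G.rightNbrs c x ∧ ¬ (d ∧ u = f) then R u ∪ (G.between x u \ T u) else R u
  have hRR' : ∀ u, R u ⊆ R' u := fun u => by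
    simp only [R']
    split_ifs
    · exact Finset.subset_union_left
    · exact Finset.Subset.refl _
  refine ⟨Φ', R', ?_, ?_, ?_, ?_, ?_, ?_⟩
  · intro u w e hu hw
    have hd := h.disjoint
    have hun' := fun z hz he => hun z hz e he
    have hz := fun z z' hz he hz' he' =>
      (rightEdge_unique (c := c) (G := G) (x := x) (x' := x) (z := z) (z' := z') (e := e)
        hz he hz' he').2
    rw [hs.mem] at hu hw
    have := hs.fav
    grind
  · intro e
    constructor
    · rintro ⟨w, hw⟩
      rcases (hs.mem e w).1 hw with ⟨hw, -⟩ | ⟨-, -, hw⟩ | ⟨z, hz, he, -⟩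
      · obtain ⟨x', hx', h'⟩ := (h.owned e).1 ⟨_, hw⟩
        exact ⟨x', Or.inr hx', h'⟩
      · obtain ⟨x', hx', h'⟩ := (h.owned e).1 ⟨_, hw⟩
        exact ⟨x', Or.inr hx', h'⟩
      · exact ⟨x, Or.inl rfl, z, hz, he⟩
    · rintro ⟨x', rfl | hx', z, hz, he⟩
      · have hex : ∃ w, ((e ∈ T z ∧ ¬ (d ∧ z = f) ∧ w = z) ∨ (e ∈ T z ∧ d ∧ z = f ∧ w = x') ∨
          (e ∉ T z ∧ ¬ d ∧ w = x') ∨ (e ∉ T z ∧ d ∧ w = f)) := by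
          by_cases h1 : e ∈ T z
          · by_cases h2 : d ∧ z = f
            · exact ⟨x', by tauto⟩
            · exact ⟨z, by tauto⟩
          · by_cases h2 : d
            · exact ⟨f, by tauto⟩
            · exact ⟨x', by tauto⟩
        obtain ⟨w, hw⟩ := hex
        exact ⟨w, (hs.mem e w).2 (Or.inr (Or.inr ⟨z, hz, he, hw⟩))⟩
      · obtain ⟨w, hw⟩ := (h.owned e).2 ⟨x', hx', z, hz, he⟩
        by_cases hd : d ∧ w = x
        · exact ⟨f, (hs.mem e f).2 (Or.inr (Or.inl ⟨hd.1, rfl, hd.2 ▸ hw⟩))⟩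
        · exact ⟨w, (hs.mem e w).2 (Or.inl ⟨hw, fun h1 h2 => hd ⟨h2, h1⟩⟩)⟩
  · intro u hu z hz
    by_cases hux : u = x
    · subst hux
      simp only [Φ', if_true]
      split_ifs with hd
      · exact hs.dump hd.1
      · exact hs.best z hz
    · simp only [Φ', hux, if_false]
      exact (h.sent u (hu.resolve_left hux) z hz).trans (hs.le hv u)
  · intro u
    simp only [R']
    split_ifs with hu
    · have hsub : A u ∪ T u ⊆ A' u := by
        refine Finset.union_subset (hs.superset (hN u hu.1).2) fun e he => ?_
        exact (hs.mem e u).2 (Or.inr (Or.inr ⟨u, hu.1, hs.sub u hu.1 he, Or.inl ⟨he, hu.2, rfl⟩⟩))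
      refine le_trans ?_ ((hv u).mono hsub)
      refine (hv u).union_le_union (h.conceded u) (hs.pref u hu.1) ?_
      rw [Finset.disjoint_left]
      intro e he he'
      have heb : e ∈ G.between x u := by
        rcases Finset.mem_union.1 he' with h' | h'
        · exact hs.sub u hu.1 h'
        · exact (Finset.mem_sdiff.1 h').1
      rcases Finset.mem_union.1 he with h' | h'
      · exact hun u hu.1 e heb u h'
      -- Earlier concessions of `u` are edges from resolved vertices, hence disjoint from the edges
      -- to `x`. This disjointness is what cancellability requires.
      · obtain ⟨y, hy, hy1, hy2⟩ := h.left u e h'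
        exact hx ((rightEdge_unique hu.1 heb hy1 hy2).1 ▸ hy)
    · exact (h.conceded u).trans (hs.le hv u)
  · intro u e he
    have hR : e ∈ R u → ∃ y ∈ insert x D, u ∈ G.rightNbrs c y ∧ e ∈ G.between y u := fun he => by
      obtain ⟨y, hy, h'⟩ := h.left u e he
      exact ⟨y, Or.inr hy, h'⟩
    simp only [R'] at he
    split_ifs at he with hu
    · rcases Finset.mem_union.1 he with h' | h'
      · exact hR h'
      · exact ⟨x, Or.inl rfl, hu.1, (Finset.mem_sdiff.1 h').1⟩
    · exact hR he
  · intro u w e huw he hue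
    have hend : ∀ z, e ∈ G.between x z → u = x ∨ u = z := fun z hz => by
      rw [MultiGraph.mem_between] at hz
      rw [hz] at hue
      exact Sym2.mem_iff.1 hue
    -- The good stayed where it was, was dumped with the old bundle of `x`, or is an edge handed out
    -- in this step.
    rcases (hs.mem e w).1 he with ⟨hw, -⟩ | ⟨hd, rfl, hw⟩ | ⟨z, hz, heb, hzw⟩
    · rcases h.routed u w e huw hw hue with ⟨hu, z, hz, hr, he'⟩ | ⟨y, hy, hr, he'⟩ | ⟨hwD, hγ⟩
      · refine Or.inl ⟨Or.inr hu, z, hz, hr, ?_⟩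
        have : u ≠ x := fun h => hx (h ▸ hu)
        simpa only [Φ', this, if_false] using he'
      · exact Or.inr (Or.inl ⟨y, hy, hr, hRR' u he'⟩)
      -- A resolved `w` is neither `x` nor one of its right neighbours, so its bundle is frozen and
      -- the EFX comparison persists.
      · have hww : A' w = A w := by
          ext e'
          have h1 : w ≠ x := fun h => hx (h ▸ hwD)
          have h2 : ∀ z ∈ G.rightNbrs c x, w ≠ z := fun z hz h => (hN z hz).1 (h ▸ hwD)
          have h3 := h2 f hs.fav
          rw [hs.mem]
          grind
        refine Or.inr (Or.inr ⟨Or.inr hwD, ?_⟩)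
        rw [hww]
        exact hγ.imp (fun h => h.trans (hs.le hv u)) fun h y hy => (h y hy).trans (hs.le hv u)
    · rcases eq_or_ne u x with rfl | hux
      · refine Or.inl ⟨Or.inl rfl, w, hs.fav, .of_adj hxf, ?_⟩
        simp [Φ', hd, hw]
      · rcases h.routed u x e hux hw hue with ⟨hu, z, hz, hr, he'⟩ | ⟨y, hy, hr, he'⟩ | ⟨hxD, -⟩
        · refine Or.inl ⟨Or.inr hu, z, hz, hr.extend hxf hcf huw, ?_⟩
          simpa only [Φ', hux, if_false] using he'
        · exact Or.inr (Or.inl ⟨y, hy, hr.extend hxf hcf huw, hRR' u he'⟩)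
        · exact absurd hxD hx
    · have hcz := (MultiGraph.mem_rightNbrs.1 hz).2
      have hR'z : e ∉ T z → ¬ (d ∧ z = f) → e ∈ R' z := fun h1 h2 => by
        simp only [R']
        rw [if_pos ⟨hz, h2⟩]
        exact Finset.mem_union_right _ (Finset.mem_sdiff.2 ⟨heb, h1⟩)
      -- In order: `z` keeps its part; `x` holds `T f` after a dump; `x` keeps what `z` cut off; `f`
      -- receives in a dump what `z` cut off.
      rcases hzw with ⟨hT, hdz, rfl⟩ | ⟨hT, hd, rfl, rfl⟩ | ⟨hT, hd, rfl⟩ | ⟨hT, hd, rfl⟩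
      · obtain rfl := (hend w heb).resolve_right huw
        refine Or.inl ⟨Or.inl rfl, w, hz, .of_adj (hadj heb), ?_⟩
        simpa only [Φ', if_true, hdz, if_false] using hT
      · obtain rfl := (hend z heb).resolve_left huw
        refine Or.inr (Or.inr ⟨Or.inl rfl, ?_⟩)
        have h1 : A' w = T u := by
          ext e'
          have hs' := hs.sub u hz
          have hz' := fun z' hz' he he' =>
            (rightEdge_unique (c := c) (G := G) (x := w) (x' := w) (z := u) (z' := z') (e := e')
              hz he hz' he').2
          have : e' ∈ T u → e' ∈ G.between w u := fun h => hs' h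
          rw [hs.mem]
          grind
        have h2 : v u (G.between w u \ T u) ≤ v u (A' u) := by
          refine (hv u).mono fun e' he' => ?_
          rw [Finset.mem_sdiff] at he'
          exact (hs.mem e' u).2 (Or.inr (Or.inr
            ⟨u, hz, he'.1, Or.inr (Or.inr (Or.inr ⟨he'.2, hd, rfl⟩))⟩))
        rw [h1]
        exact (hs.efx hd).imp (fun h => h.trans h2) fun h y hy => (h y hy).trans h2
      · obtain rfl := (hend z heb).resolve_left huw
        exact Or.inr (Or.inl ⟨w, hcz, .of_adj (hadj heb).symm, hR'z hT fun h => hd h.1⟩)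
      · rcases hend z heb with rfl | rfl
        · refine Or.inl ⟨Or.inl rfl, w, hs.fav, .of_adj hxf, ?_⟩
          have : e ∈ concession G c u T :=
            Finset.mem_biUnion.2 ⟨z, hz, Finset.mem_sdiff.2 ⟨heb, hT⟩⟩
          simp [Φ', hd, this]
        -- The good conceded by `u` to `x` goes straight on to `f`, along the route `u`, `x`, `f`.
        · exact Or.inr (Or.inl ⟨x, hcz, (Route.of_adj (hadj heb).symm).extend hxf hcf huw,
            hR'z hT fun h => huw h.2⟩)

theorem Resolves.isInvariant {c : V → Fin t} {x : V} {A A' : V → Finset E}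
    {D : Set V} {Φ : V → V → Finset E} {R : V → Finset E} (hv : ∀ w, IsCancellable (v w))
    (h : IsInvariant G c v D A Φ R) (hx : x ∉ D) (hD : ∀ y ∈ D, c y ≤ c x)
    (hs : Resolves G c v x A A') :
    ∃ Φ' R', IsInvariant G c v (insert x D) A' Φ' R' := by
  rcases hs.isStep hv with ⟨h0, rfl⟩ | ⟨f, d, T, hs⟩
  · refine ⟨Φ, R, h.disjoint, fun e => ?_, ?_, h.conceded, fun u e he => ?_, ?_⟩
    · rw [h.owned]
      simp [h0]
    · rintro u (rfl | hu) z hz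
      · simp [h0] at hz
      · exact h.sent u hu z hz
    · obtain ⟨y, hy, h'⟩ := h.left u e he
      exact ⟨y, Or.inr hy, h'⟩
    · intro u w e huw he hue
      rcases h.routed u w e huw he hue with ⟨hu, h'⟩ | h' | ⟨hu, h'⟩
      · exact Or.inl ⟨Or.inr hu, h'⟩
      · exact Or.inr (Or.inl h')
      · exact Or.inr (Or.inr ⟨Or.inr hu, h'⟩)
  · exact hs.isInvariant hv h hx hD

theorem ResolvesList.isInvariant {c : V → Fin t} {i : Fin t} {l : List V} {A A' : V → Finset E}
    {D : Set V} {Φ : V → V → Finset E} {R : V → Finset E} (hv : ∀ w, IsCancellable (v w))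
    (h : IsInvariant G c v D A Φ R) (hl : l.Nodup) (hlD : ∀ x ∈ l, x ∉ D) (hli : ∀ x ∈ l, c x = i)
    (hD : ∀ y ∈ D, c y ≤ i) (hs : ResolvesList G c v l A A') :
    ∃ Φ' R', IsInvariant G c v (D ∪ {x | x ∈ l}) A' Φ' R' := by
  induction l generalizing D A Φ R with
  | nil =>
    obtain rfl : A' = A := hs
    exact ⟨Φ, R, by simpa using h⟩
  | cons x l ih =>
    obtain ⟨B, hB, hs⟩ := hs
    have hxi := hli x (by simp)
    obtain ⟨Φ₁, R₁, h₁⟩ := hB.isInvariant hv h (hlD x (by simp)) (hxi ▸ hD)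
    obtain ⟨hxl, hl⟩ := List.nodup_cons.1 hl
    have := ih h₁ hl
      (fun y hy => by
        rintro (rfl | hyD)
        · exact hxl hy
        · exact hlD y (by simp [hy]) hyD)
      (fun y hy => hli y (by simp [hy]))
      (by
        rintro y (rfl | hy)
        · exact hxi.le
        · exact hD y hy) hs
    have e : D ∪ {y | y ∈ x :: l} = insert x D ∪ {y | y ∈ l} := by
      ext y
      simp only [Set.mem_union, Set.mem_insert_iff, Set.mem_ofPred_eq, List.mem_cons]
      tauto
    rwa [e]

theorem phases_isInvariant {c : V → Fin t} (hv : ∀ w, IsCancellable (v w))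
    {B : ℕ → V → Finset E} (h0 : B 0 = fun _ => ∅) {k : ℕ} (hk : k ≤ t - 1)
    (hB : ∀ i, i < k → Phase G c v i (B i) (B (i + 1))) :
    ∃ Φ R, IsInvariant G c v {x | (c x : ℕ) < k} (B k) Φ R := by
  induction k with
  | zero =>
    refine ⟨fun _ _ => ∅, fun _ => ∅, ?_⟩
    rw [h0]
    simpa using isInvariant_empty G c v
  | succ k ih =>
    obtain ⟨Φ, R, h⟩ := ih (by omega) fun i hi => hB i (by omega)
    obtain ⟨l, hl, hmem, hs⟩ := hB k (by omega)
    have := hs.isInvariant (i := ⟨k, by omega⟩) hv h hl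
      (fun x hx => by have := (hmem x).1 hx; simp [this])
      (fun x hx => Fin.ext ((hmem x).1 hx))
      (fun y hy => Fin.le_def.2 (le_of_lt hy))
    have e : {x | (c x : ℕ) < k + 1} = {x | (c x : ℕ) < k} ∪ {x | x ∈ l} := by
      ext y
      simp only [Set.mem_union, Set.mem_ofPred_eq, hmem]
      omega
    rwa [e]

theorem IsOutput.isAllocation_isEFX {c : G.simple.Coloring (Fin t)} {A : V → Finset E}
    (hg : ((2 * t - 1 : ℕ) : ℕ∞) ≤ G.simple.egirth) (hr : G.Respects v)
    (hv : ∀ u, IsCancellable (v u)) (h : IsOutput G c v A) : IsAllocation A ∧ IsEFX v A := by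
  obtain ⟨B, h0, hB, rfl⟩ := h
  obtain ⟨Φ, R, h⟩ := phases_isInvariant hv h0 le_rfl hB
  refine ⟨⟨fun u w huw => ?_, fun e => ?_⟩, h.isEFX hg hr hv⟩
  · exact Finset.disjoint_left.2 fun e hu hw => huw (h.disjoint u w e hu hw)
  -- The endpoint of smaller colour has a colour above it, so it is not in the last class and has
  -- been resolved.
  · have key : ∀ x z, G.ends e = s(x, z) → c x < c z →
        ∃ x ∈ {x | (c x : ℕ) < t - 1}, ∃ z ∈ G.rightNbrs c x, e ∈ G.between x z := by
      intro x z hxz hc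
      refine ⟨x, ?_, z, MultiGraph.mem_rightNbrs.2 ⟨⟨e, hxz⟩, hc⟩, MultiGraph.mem_between.2 hxz⟩
      have h1 : (c x : ℕ) < c z := hc
      have h2 := (c z).isLt
      simp only [Set.mem_ofPred_eq]
      omega
    rw [h.owned]
    obtain ⟨x, z, hxz⟩ : ∃ x z, G.ends e = s(x, z) := by
      induction hz : G.ends e with
      | _ x z => exact ⟨x, z, rfl⟩
    rcases lt_trichotomy (c x) (c z) with hc | hc | hc
    · exact key x z hxz hc
    · exact absurd hc (c.valid ⟨e, hxz⟩)
    · exact key z x (hxz.trans Sym2.eq_swap) hc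

/-! ### The algorithm can always be executed -/

theorem MultiGraph.between_nonempty {c : V → Fin t} {u w : V} (hw : w ∈ G.rightNbrs c u) :
    (G.between u w).Nonempty := by
  obtain ⟨⟨e, he⟩, -⟩ := MultiGraph.mem_rightNbrs.1 hw
  exact ⟨e, MultiGraph.mem_between.2 he⟩

/-- The tie-breaking rule demands `S w ≠ T w`, which is possible only because the two parts of a
nonempty set differ. -/
theorem IsCut.ne {f : Finset E → ℕ} {B P Q : Finset E} (h : IsCut f B P Q) (hB : B.Nonempty) :
    P ≠ Q := by
  rintro rfl
  have h1 := h.disjoint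
  rw [disjoint_self] at h1
  rw [← h.union, h1] at hB
  simp at hB

theorem exists_preferred (f g : Finset E → ℕ) {P Q : Finset E} (hPQ : P ≠ Q) :
    ∃ S T, IsPreferred f P Q S ∧ IsPreferred g P Q T ∧ (f P = f Q ∨ g P = g Q → S ≠ T) := by
  unfold IsPreferred
  rcases lt_trichotomy (f P) (f Q) with h | h | h <;>
    rcases lt_trichotomy (g P) (g Q) with h' | h' | h'
  · exact ⟨Q, Q, by simp [h.le, h'.le, h.ne, h'.ne]⟩
  · exact ⟨Q, P, by simp [h.le, h', h.ne, hPQ.symm]⟩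
  · exact ⟨Q, P, by simp [h.le, h'.le, h.ne, hPQ.symm]⟩
  · exact ⟨P, Q, by simp [h, h'.le, h'.ne, hPQ]⟩
  · exact ⟨P, Q, by simp [h, h', hPQ]⟩
  · exact ⟨Q, P, by simp [h, h'.le, hPQ.symm]⟩
  · exact ⟨P, Q, by simp [h.le, h'.le, hPQ]⟩
  · exact ⟨P, Q, by simp [h.le, h', hPQ]⟩
  · exact ⟨P, P, by simp [h.le, h'.le, h.ne', h'.ne']⟩

theorem exists_resolves (c : V → Fin t) (hv : ∀ w, IsCancellable (v w)) (u : V)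
    (A : V → Finset E) : ∃ A', Resolves G c v u A A' := by
  rcases (G.rightNbrs c u).eq_empty_or_nonempty with h | h
  · exact ⟨A, Or.inl ⟨h, rfl⟩⟩
  -- Membership is assumed inside the existential so that `choose` gives functions defined on all
  -- vertices.
  · have hcut : ∀ w, ∃ S T : Finset E, w ∈ G.rightNbrs c u → ∃ P Q : Finset E,
        IsCut (v w) (G.between u w) P Q ∧ IsPreferred (v u) P Q S ∧ IsPreferred (v w) P Q T ∧
        (v u P = v u Q ∨ v w P = v w Q → S ≠ T) := by
      intro w
      by_cases hw : w ∈ G.rightNbrs c u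
      · obtain ⟨P, Q, hPQ⟩ := exists_isCut (hv w) (G.between u w)
        obtain ⟨S, T, h'⟩ := exists_preferred (v u) (v w)
          (hPQ.ne (MultiGraph.between_nonempty hw))
        exact ⟨S, T, fun _ => ⟨P, Q, hPQ, h'⟩⟩
      · exact ⟨∅, ∅, fun h => absurd h hw⟩
    choose S T hST using hcut
    obtain ⟨f, hf, hmax⟩ := Finset.exists_max_image _ (fun w => v u (S w)) h
    exact ⟨_, Or.inr ⟨S, T, f, hST, hf, hmax, rfl⟩⟩

theorem exists_resolvesList (c : V → Fin t) (hv : ∀ w, IsCancellable (v w)) (l : List V)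
    (A : V → Finset E) : ∃ A', ResolvesList G c v l A A' := by
  induction l generalizing A with
  | nil => exact ⟨A, rfl⟩
  | cons u l ih =>
    obtain ⟨B, hB⟩ := exists_resolves (G := G) c hv u A
    obtain ⟨A', hA'⟩ := ih B
    exact ⟨A', B, hB, hA'⟩

theorem exists_isOutput (G : MultiGraph V E) (c : V → Fin t) (hv : ∀ w, IsCancellable (v w)) :
    ∃ A, IsOutput G c v A := by
  have hphase : ∀ (i : ℕ) (A : V → Finset E), ∃ A', Phase G c v i A A' := by
    intro i A
    obtain ⟨A', h⟩ := exists_resolvesList (G := G) c hv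
      (Finset.univ.filter fun u => (c u : ℕ) = i).toList A
    exact ⟨A', _, Finset.nodup_toList _, by simp, h⟩
  choose F hF using hphase
  refine ⟨_, fun k => Nat.rec (fun _ => ∅) F k, rfl, fun i _ => hF i _, rfl⟩

end Step

/-! ### Reasoning about programs -/

section Programs

/-- The program does not write to variable `y`. -/
def Prog.keepsVar (y : ℕ) : Prog → Bool
  | .skip => true
  | .setVar x _ => x != y
  | .setArr _ _ _ => true
  | .query x _ _ => x != y
  | .seq c₁ c₂ => c₁.keepsVar y && c₂.keepsVar y
  | .ifLe _ _ c₁ c₂ => c₁.keepsVar y && c₂.keepsVar y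
  | .loop x _ c => x != y && c.keepsVar y

/-- The program does not write to array `b`. -/
def Prog.keepsArr (b : ℕ) : Prog → Bool
  | .skip => true
  | .setVar _ _ => true
  | .setArr a _ _ => a != b
  | .query _ _ _ => true
  | .seq c₁ c₂ => c₁.keepsArr b && c₂.keepsArr b
  | .ifLe _ _ c₁ c₂ => c₁.keepsArr b && c₂.keepsArr b
  | .loop _ _ c => c.keepsArr b

variable {O : ℕ → (ℕ → ℕ) → ℕ}

theorem Mem.setVar_var_of_ne {σ : Mem} {x y k : ℕ} (h : x ≠ y) :
    (σ.setVar x k).var y = σ.var y := by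
  simp [Mem.setVar, h.symm]

theorem Mem.setVar_var {σ : Mem} {x y k : ℕ} :
    (σ.setVar x k).var y = if y = x then k else σ.var y := by
  simp [Mem.setVar, Function.update_apply]

theorem Mem.setVar_arr {σ : Mem} {x k : ℕ} : (σ.setVar x k).arr = σ.arr := rfl

theorem Mem.setArr_var {σ : Mem} {a i k : ℕ} : (σ.setArr a i k).var = σ.var := rfl

theorem Mem.setArr_arr {σ : Mem} {a i k b j : ℕ} :
    (σ.setArr a i k).arr b j = if b = a then if j = i then k else σ.arr a j else σ.arr b j := by
  by_cases h : b = a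
  · subst h
    simp [Mem.setArr, Function.update_apply]
  · simp [Mem.setArr, h]

theorem rounds_induct {body : ℕ → Mem → Mem} {σ : Mem} (I : ℕ → Mem → Prop) (h0 : I 0 σ) (K : ℕ)
    (hs : ∀ k τ, k < K → I k τ → I (k + 1) (body k τ)) : I K (rounds body σ K) := by
  induction K with
  | zero => exact h0
  | succ K ih => exact hs K _ (by omega) (ih fun k τ hk => hs k τ (by omega))

/-- The check is syntactic and Boolean, so for a concrete program `rfl` discharges it; this is the
frame rule used throughout. -/
theorem Prog.run_var {c : Prog} {y : ℕ} (h : c.keepsVar y = true) (σ : Mem) :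
    (c.run O σ).var y = σ.var y := by
  induction c generalizing σ with
  | skip => rfl
  | setVar x e => exact Mem.setVar_var_of_ne (by simpa [Prog.keepsVar] using h)
  | setArr a i e => rfl
  | query x e a => exact Mem.setVar_var_of_ne (by simpa [Prog.keepsVar] using h)
  | seq c₁ c₂ ih₁ ih₂ =>
    simp only [Prog.keepsVar, Bool.and_eq_true] at h
    simp only [Prog.run]
    rw [ih₂ h.2, ih₁ h.1]
  | ifLe e₁ e₂ c₁ c₂ ih₁ ih₂ =>
    simp only [Prog.keepsVar, Bool.and_eq_true] at h
    simp only [Prog.run]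
    split_ifs
    · exact ih₁ h.1 σ
    · exact ih₂ h.2 σ
  | loop x e c ih =>
    simp only [Prog.keepsVar, Bool.and_eq_true, bne_iff_ne] at h
    simp only [Prog.run]
    refine rounds_induct (fun _ τ => τ.var y = σ.var y) rfl _ fun k τ _ hτ => ?_
    rw [ih h.2, Mem.setVar_var_of_ne h.1, hτ]

theorem Prog.run_arr {c : Prog} {b : ℕ} (h : c.keepsArr b = true) (σ : Mem) :
    (c.run O σ).arr b = σ.arr b := by
  induction c generalizing σ with
  | skip => rfl
  | setVar x e => rfl
  | setArr a i e =>
    have : a ≠ b := by simpa [Prog.keepsArr] using h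
    simp [Prog.run, Mem.setArr, this.symm]
  | query x e a => rfl
  | seq c₁ c₂ ih₁ ih₂ =>
    simp only [Prog.keepsArr, Bool.and_eq_true] at h
    simp only [Prog.run]
    rw [ih₂ h.2, ih₁ h.1]
  | ifLe e₁ e₂ c₁ c₂ ih₁ ih₂ =>
    simp only [Prog.keepsArr, Bool.and_eq_true] at h
    simp only [Prog.run]
    split_ifs
    · exact ih₁ h.1 σ
    · exact ih₂ h.2 σ
  | loop x e c ih =>
    simp only [Prog.keepsArr] at h
    simp only [Prog.run]
    refine rounds_induct (fun _ τ => τ.arr b = σ.arr b) rfl _ fun k τ _ hτ => ?_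
    rw [ih h]
    exact hτ

/-- The weakest precondition of `Q`. -/
def Prog.wp (O : ℕ → (ℕ → ℕ) → ℕ) (c : Prog) (Q : Mem → Prop) (σ : Mem) : Prop := Q (c.run O σ)

theorem Prog.wp_iff {c : Prog} {Q : Mem → Prop} {σ : Mem} : c.wp O Q σ ↔ Q (c.run O σ) := Iff.rfl

theorem Prog.wp_skip {Q : Mem → Prop} {σ : Mem} : Prog.skip.wp O Q σ ↔ Q σ := Iff.rfl

theorem Prog.wp_setVar {x : ℕ} {e : Expr} {Q : Mem → Prop} {σ : Mem} :
    (Prog.setVar x e).wp O Q σ ↔ Q (σ.setVar x (e.eval σ)) := Iff.rfl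

theorem Prog.wp_setArr {a : ℕ} {i e : Expr} {Q : Mem → Prop} {σ : Mem} :
    (Prog.setArr a i e).wp O Q σ ↔ Q (σ.setArr a (i.eval σ) (e.eval σ)) := Iff.rfl

theorem Prog.wp_query {x a : ℕ} {e : Expr} {Q : Mem → Prop} {σ : Mem} :
    (Prog.query x e a).wp O Q σ ↔ Q (σ.setVar x (O (e.eval σ) (σ.arr a))) := Iff.rfl

theorem Prog.wp_seq {c₁ c₂ : Prog} {Q : Mem → Prop} {σ : Mem} :
    (Prog.seq c₁ c₂).wp O Q σ ↔ c₁.wp O (fun τ => c₂.wp O Q τ) σ := Iff.rfl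

theorem Prog.wp_ifLe {e₁ e₂ : Expr} {c₁ c₂ : Prog} {Q : Mem → Prop} {σ : Mem} :
    (Prog.ifLe e₁ e₂ c₁ c₂).wp O Q σ ↔
      (e₁.eval σ ≤ e₂.eval σ → c₁.wp O Q σ) ∧ (e₂.eval σ < e₁.eval σ → c₂.wp O Q σ) := by
  simp only [Prog.wp, Prog.run]
  by_cases h : e₁.eval σ ≤ e₂.eval σ
  · simp [h]
  · simp [h, not_le.1 h]

/-- The loop rule. Variables and arrays to which the loop does not write keep their contents. -/
theorem Prog.run_loop_induct {prog : Prog} {x : ℕ} {e : Expr} {c : Prog}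
    (hprog : prog = .loop x e c) {σ : Mem} (I : ℕ → Mem → Prop)
    (h0 : I 0 σ)
    (hs : ∀ k τ, k < e.eval σ →
      (∀ y, prog.keepsVar y = true → τ.var y = σ.var y) →
      (∀ b, prog.keepsArr b = true → τ.arr b = σ.arr b) →
      I k τ → c.wp O (I (k + 1)) (τ.setVar x k)) :
    I (e.eval σ) (prog.run O σ) := by
  subst hprog
  simp only [Prog.run]
  refine (rounds_induct (fun k τ => I k τ ∧
    (∀ y, (Prog.loop x e c).keepsVar y = true → τ.var y = σ.var y) ∧
    (∀ b, (Prog.loop x e c).keepsArr b = true → τ.arr b = σ.arr b))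
    ⟨h0, fun _ _ => rfl, fun _ _ => rfl⟩ _ ?_).1
  rintro k τ hk ⟨hI, hv, ha⟩
  refine ⟨hs k τ hk hv ha hI, fun y hy => ?_, fun b hb => ?_⟩
  · have h := hy
    simp only [Prog.keepsVar, Bool.and_eq_true, bne_iff_ne] at h
    rw [Prog.run_var h.2, Mem.setVar_var_of_ne h.1, hv y hy]
  · rw [Prog.run_arr (by simpa only [Prog.keepsArr] using hb), ← ha b hb]
    rfl

/-! ### Polynomial running time -/

/-- The value of the expression is at most one of the variables `0`, `1`, `2`. -/
def Expr.isSmall : Expr → Bool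
  | .var x => decide (x < 3)
  | .sub e _ => e.isSmall
  | _ => false

/-- The loops are bounded by the variables `0`, `1`, `2`, which are never overwritten. -/
def Prog.isSmall : Prog → Bool
  | .skip => true
  | .setVar x _ => decide (3 ≤ x)
  | .setArr _ _ _ => true
  | .query x _ _ => decide (3 ≤ x)
  | .seq c₁ c₂ => c₁.isSmall && c₂.isSmall
  | .ifLe _ _ c₁ c₂ => c₁.isSmall && c₂.isSmall
  | .loop x e c => decide (3 ≤ x) && e.isSmall && c.isSmall

theorem Expr.eval_le_of_isSmall {e : Expr} (h : e.isSmall = true) {σ : Mem} {N : ℕ}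
    (hσ : ∀ x < 3, σ.var x ≤ N) : e.eval σ ≤ N := by
  induction e with
  | const k => simp [Expr.isSmall] at h
  | var x => exact hσ x (by simpa [Expr.isSmall] using h)
  | read a i => simp [Expr.isSmall] at h
  | add e₁ e₂ => simp [Expr.isSmall] at h
  | sub e₁ e₂ ih =>
    have := ih (by simpa [Expr.isSmall] using h)
    simp only [Expr.eval]
    omega

theorem Prog.keepsVar_of_isSmall {c : Prog} (h : c.isSmall = true) {x : ℕ} (hx : x < 3) :
    c.keepsVar x = true := by
  induction c with
  | skip => rfl
  | setVar y e => simp [Prog.isSmall] at h; simp [Prog.keepsVar]; omega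
  | setArr a i e => rfl
  | query y e a => simp [Prog.isSmall] at h; simp [Prog.keepsVar]; omega
  | seq c₁ c₂ ih₁ ih₂ =>
    simp only [Prog.isSmall, Bool.and_eq_true] at h
    simp [Prog.keepsVar, ih₁ h.1, ih₂ h.2]
  | ifLe e₁ e₂ c₁ c₂ ih₁ ih₂ =>
    simp only [Prog.isSmall, Bool.and_eq_true] at h
    simp [Prog.keepsVar, ih₁ h.1, ih₂ h.2]
  | loop y e c ih =>
    simp only [Prog.isSmall, Bool.and_eq_true, decide_eq_true_eq] at h
    simp only [Prog.keepsVar, ih h.2, Bool.and_true, bne_iff_ne]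
    omega

/-- By induction on the program: the bounds of two branches or successive programs are added, and a
loop multiplies the bound of its body by at most `N`. The variables that bound the loops are never
overwritten, so the same `N` serves every subprogram at every moment. -/
theorem Prog.exists_time_le {c : Prog} (h : c.isSmall = true) :
    ∃ p : Polynomial ℕ, ∀ (O : ℕ → (ℕ → ℕ) → ℕ) (σ : Mem) (N : ℕ),
      (∀ x < 3, σ.var x ≤ N) → c.time O σ ≤ p.eval N := by
  induction c with
  | skip => exact ⟨1, fun O σ N _ => by simp [Prog.time]⟩
  | setVar x e => exact ⟨.C (1 + e.size), fun O σ N _ => by simp [Prog.time]⟩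
  | setArr a i e => exact ⟨.C (1 + i.size + e.size), fun O σ N _ => by simp [Prog.time]⟩
  | query x e a => exact ⟨.C (1 + e.size), fun O σ N _ => by simp [Prog.time]⟩
  | seq c₁ c₂ ih₁ ih₂ =>
    simp only [Prog.isSmall, Bool.and_eq_true] at h
    obtain ⟨p, hp⟩ := ih₁ h.1
    obtain ⟨q, hq⟩ := ih₂ h.2
    refine ⟨p + q, fun O σ N hσ => ?_⟩
    simp only [Prog.time, Polynomial.eval_add]
    refine add_le_add (hp O σ N hσ) (hq O _ N fun x hx => ?_)
    rw [Prog.run_var (Prog.keepsVar_of_isSmall h.1 hx)]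
    exact hσ x hx
  | ifLe e₁ e₂ c₁ c₂ ih₁ ih₂ =>
    simp only [Prog.isSmall, Bool.and_eq_true] at h
    obtain ⟨p, hp⟩ := ih₁ h.1
    obtain ⟨q, hq⟩ := ih₂ h.2
    refine ⟨.C (1 + e₁.size + e₂.size) + (p + q), fun O σ N hσ => ?_⟩
    have h₁ := hp O σ N hσ
    have h₂ := hq O σ N hσ
    simp only [Prog.time, Polynomial.eval_add, Polynomial.eval_C]
    split_ifs <;> omega
  | loop x e c ih =>
    simp only [Prog.isSmall, Bool.and_eq_true, decide_eq_true_eq] at h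
    obtain ⟨p, hp⟩ := ih h.2
    refine ⟨.C (1 + e.size) + .X * (1 + p), fun O σ N hσ => ?_⟩
    simp only [Prog.time, Polynomial.eval_add, Polynomial.eval_C, Polynomial.eval_mul,
      Polynomial.eval_X, Polynomial.eval_one]
    refine Nat.add_le_add_left ?_ _
    refine (Finset.sum_le_card_nsmul _ _ (1 + p.eval N) fun i _ => ?_).trans ?_
    · refine Nat.add_le_add_left (hp O _ N ?_) _
      have hset : ∀ {τ : Mem} {k : ℕ}, (∀ y < 3, τ.var y ≤ N) →
          ∀ y < 3, (τ.setVar x k).var y ≤ N := fun hτ y hy => by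
        rw [Mem.setVar_var_of_ne (by omega)]
        exact hτ y hy
      refine hset (rounds_induct (fun _ τ => ∀ y < 3, τ.var y ≤ N) hσ i fun k τ _ hτ y hy => ?_)
      rw [Prog.run_var (Prog.keepsVar_of_isSmall h.2 hy)]
      exact hset hτ y hy
    · rw [Finset.card_range, smul_eq_mul]
      exact Nat.mul_le_mul_right _ (Expr.eval_le_of_isSmall h.1.2 hσ)

end Programs

/-! ### The program -/

section TheProgram

local infixr:60 " ;; " => Prog.seq

/-- Run `c` if `e₁ < e₂`. -/
def Prog.ifLt (e₁ e₂ : Expr) (c : Prog) : Prog := .ifLe e₂ e₁ .skip c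

/-- Run `c` if `e₁ = e₂`. -/
def Prog.ifEq (e₁ e₂ : Expr) (c : Prog) : Prog := .ifLe e₁ e₂ (.ifLe e₂ e₁ c .skip) .skip

/-- Array `8` receives, for each edge between the vertex in variable `4` and one of its right
neighbours, that neighbour, and the number of vertices for each other edge. -/
def rightEnds : Prog :=
  .loop 7 (.var 1) (
    .setArr 8 (.var 7) (.var 0) ;;
    .ifEq (.read 0 (.var 7)) (.var 4) (
      .ifLt (.read 2 (.var 4)) (.read 2 (.read 1 (.var 7)))
        (.setArr 8 (.var 7) (.read 1 (.var 7)))) ;;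
    .ifEq (.read 1 (.var 7)) (.var 4) (
      .ifLt (.read 2 (.var 4)) (.read 2 (.read 0 (.var 7)))
        (.setArr 8 (.var 7) (.read 0 (.var 7)))))

/-- The loop of `clearParts`. -/
def clearLoop : Prog :=
  .loop 7 (.var 1) (
    .setArr 4 (.var 7) (.const 0) ;;
    .setArr 5 (.var 7) (.const 0) ;;
    .ifEq (.read 8 (.var 7)) (.var 5) (.setVar 17 (.const 1)))

/-- Empty the arrays `4` and `5` (the two parts of a cut), and let variable `17` tell whether the
vertex in variable `5` is a right neighbour. -/
def clearParts : Prog := .setVar 17 (.const 0) ;; clearLoop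

/-- The loop of `selectBest`. -/
def selectLoop : Prog :=
  .loop 7 (.var 1) (
    .ifEq (.read 8 (.var 7)) (.var 5) (
      .ifLe (.read 4 (.var 7)) (.const 0) (
        .ifLe (.read 5 (.var 7)) (.const 0) (
          .setArr 6 (.var 7) (.const 1) ;;
          .query 10 (.var 5) 6 ;;
          .setArr 6 (.var 7) (.const 0) ;;
          .ifLe (.var 9) (.var 10)
            (.setVar 9 (.add (.var 10) (.const 1)) ;; .setVar 8 (.var 7)) .skip)
          .skip)
        .skip))

/-- Variable `8` receives an edge of largest value for the vertex in variable `5`, among those that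
are to be cut and have not been placed yet, and variable `9` receives its value plus one. Variable
`9` is zero if there is no such edge. -/
def selectBest : Prog := .setVar 9 (.const 0) ;; selectLoop

/-- Put the selected edge into the poorer part. -/
def placeBest : Prog :=
  .ifLe (.const 1) (.var 9) (
    .query 10 (.var 5) 4 ;;
    .query 11 (.var 5) 5 ;;
    .ifLe (.var 10) (.var 11)
      (.setArr 4 (.var 8) (.const 1)) (.setArr 5 (.var 8) (.const 1)))
    .skip

/-- Cut the edges between the vertices in variables `4` and `5`. -/
def cutEdges : Prog := .loop 6 (.var 1) (selectBest ;; placeBest)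

/-- Given the values of the two parts for `u` (variables `10`, `11`) and for `w` (variables `12`,
`13`), let variable `19` tell whether `w` takes the second part, let variable `18` tell whether both
take the same part, and let variable `10` be the value for `u` of the part taken by `u`. -/
def preferParts : Prog :=
  .query 10 (.var 4) 4 ;;
  .query 11 (.var 4) 5 ;;
  .query 12 (.var 5) 4 ;;
  .query 13 (.var 5) 5 ;;
  .ifLe (.var 11) (.var 10)
    (.ifLe (.var 12) (.var 13)
      (.setVar 19 (.const 1) ;; .setVar 18 (.const 0))
      (.setVar 19 (.const 0) ;;
        .ifLe (.var 10) (.var 11) (.setVar 18 (.const 0)) (.setVar 18 (.const 1))))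
    (.setVar 10 (.var 11) ;;
      .ifLe (.var 13) (.var 12)
        (.setVar 19 (.const 0) ;; .setVar 18 (.const 0))
        (.setVar 19 (.const 1) ;; .setVar 18 (.const 1)))

/-- Record in array `7` the part taken by the vertex in variable `5`. -/
def recordPart : Prog :=
  .loop 7 (.var 1) (
    .ifEq (.read 8 (.var 7)) (.var 5) (
      .ifLe (.var 19) (.const 0)
        (.setArr 7 (.var 7) (.read 4 (.var 7))) (.setArr 7 (.var 7) (.read 5 (.var 7)))))

/-- Keep track of the favourite: variable `15` holds it, variable `14` the value of its part plus
one, and variable `16` tells whether it takes the same part as `u`. -/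
def updateFavourite : Prog :=
  .ifLe (.var 14) (.var 10)
    (.setVar 14 (.add (.var 10) (.const 1)) ;; .setVar 15 (.var 5) ;; .setVar 16 (.var 18)) .skip

/-- Treat the vertex in variable `5`, if it is a right neighbour. -/
def treatNbr : Prog :=
  clearParts ;;
  .ifLe (.const 1) (.var 17)
    (cutEdges ;; preferParts ;; recordPart ;; updateFavourite) .skip

/-- The loop of `treatNbrs`. -/
def treatLoop : Prog := .loop 5 (.var 0) treatNbr

/-- Treat all right neighbours. -/
def treatNbrs : Prog :=
  .setVar 14 (.const 0) ;; .setVar 16 (.const 0) ;; treatLoop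

/-- Hand out the edges to the right neighbours: those take what they prefer, and `u` the rest. -/
def handOut : Prog :=
  .loop 7 (.var 1) (
    .ifLt (.read 8 (.var 7)) (.var 0) (
      .ifLe (.read 7 (.var 7)) (.const 0)
        (.setArr 3 (.var 7) (.var 4)) (.setArr 3 (.var 7) (.read 8 (.var 7)))))

/-- Arrays `9` and `10` receive the bundle of `u` and the part that the favourite took. -/
def compareBundles : Prog :=
  .loop 7 (.var 1) (
    .setArr 9 (.var 7) (.const 0) ;;
    .setArr 10 (.var 7) (.const 0) ;;
    .ifEq (.read 3 (.var 7)) (.var 4) (.setArr 9 (.var 7) (.const 1)) ;;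
    .ifEq (.read 8 (.var 7)) (.var 15) (.setArr 10 (.var 7) (.read 7 (.var 7))))

/-- Exchange the contents of arrays `9` and `10` between `u` and its favourite. -/
def exchange : Prog :=
  .loop 7 (.var 1) (
    .ifLe (.const 1) (.read 9 (.var 7)) (.setArr 3 (.var 7) (.var 15)) .skip ;;
    .ifLe (.const 1) (.read 10 (.var 7)) (.setArr 3 (.var 7) (.var 4)) .skip)

/-- The exchange, if `u` and its favourite want the same part and `u` wants it more than its bundle.
-/
def exchangeIfBetter : Prog :=
  .ifLe (.const 1) (.var 16) (
    compareBundles ;;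
    .query 10 (.var 4) 9 ;;
    .query 11 (.var 4) 10 ;;
    .ifLt (.var 10) (.var 11) exchange) .skip

/-- Resolve the vertex in variable `4`. -/
def resolve : Prog := rightEnds ;; treatNbrs ;; handOut ;; exchangeIfBetter

/-- No edge has an owner, and array `6` is empty. -/
def clearOwners : Prog :=
  .loop 7 (.var 1) (.setArr 3 (.var 7) (.var 0) ;; .setArr 6 (.var 7) (.const 0))

/-- One phase: all vertices are resolved whose colour is in variable `3`. -/
def runPhase : Prog := .loop 4 (.var 0) (.ifEq (.read 2 (.var 4)) (.var 3) resolve)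

/-- All phases. -/
def phases : Prog := .loop 3 (.sub (.var 2) (.const 1)) runPhase

/-- The algorithm. -/
def chromaticProg : Prog := clearOwners ;; phases

variable {O : ℕ → (ℕ → ℕ) → ℕ}

theorem Prog.wp_ifLt {e₁ e₂ : Expr} {c : Prog} {Q : Mem → Prop} {σ : Mem} :
    (Prog.ifLt e₁ e₂ c).wp O Q σ ↔
      (e₁.eval σ < e₂.eval σ → c.wp O Q σ) ∧ (¬ e₁.eval σ < e₂.eval σ → Q σ) := by
  simp only [Prog.ifLt, Prog.wp_ifLe, Prog.wp_skip, not_lt]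
  exact and_comm

theorem Prog.wp_ifEq {e₁ e₂ : Expr} {c : Prog} {Q : Mem → Prop} {σ : Mem} :
    (Prog.ifEq e₁ e₂ c).wp O Q σ ↔
      (e₁.eval σ = e₂.eval σ → c.wp O Q σ) ∧ (e₁.eval σ ≠ e₂.eval σ → Q σ) := by
  simp only [Prog.ifEq, Prog.wp_ifLe, Prog.wp_skip]
  rcases lt_trichotomy (e₁.eval σ) (e₂.eval σ) with h | h | h
  · simp [h.le, h.ne, h, h.not_gt]
  · simp [h]
  · simp [h.ne', h, h.not_ge]

variable {n m : ℕ}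

/-- The set of edges with indicator array `a`. -/
def bundleOf (m : ℕ) (a : ℕ → ℕ) : Finset (Fin m) := Finset.univ.filter fun e => a e ≠ 0

theorem mem_bundleOf {a : ℕ → ℕ} {e : Fin m} : e ∈ bundleOf m a ↔ a e ≠ 0 := by
  simp [bundleOf]

theorem valueOracle_eq (v : Fin n → Finset (Fin m) → ℕ) (u : Fin n) (a : ℕ → ℕ) :
    valueOracle v u a = v u (bundleOf m a) := by
  simp [valueOracle, bundleOf]

/-- The allocation with owners in array `3`. -/
def allocOf (n m : ℕ) (σ : Mem) (u : Fin n) : Finset (Fin m) :=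
  Finset.univ.filter fun e => σ.arr 3 e = u

theorem mem_allocOf {σ : Mem} {u : Fin n} {e : Fin m} : e ∈ allocOf n m σ u ↔ σ.arr 3 e = u := by
  simp [allocOf]

theorem isSmall_chromaticProg : chromaticProg.isSmall = true := rfl

variable {t : ℕ} {G : MultiGraph (Fin n) (Fin m)} {c : Fin n → Fin t}

theorem HoldsInput.congr {σ τ : Mem} (h : HoldsInput G c σ) (hv : ∀ x < 3, τ.var x = σ.var x)
    (ha : ∀ b < 3, τ.arr b = σ.arr b) : HoldsInput G c τ := by
  refine ⟨?_, ?_, ?_, ?_, ?_⟩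
  · rw [hv 0 (by omega), h.numVertices]
  · rw [hv 1 (by omega), h.numEdges]
  · rw [hv 2 (by omega), h.numColours]
  · rw [ha 0 (by omega), ha 1 (by omega)]; exact h.endpoints
  · rw [ha 2 (by omega)]; exact h.colours

/-- Array `8` is as described for `rightEnds`. -/
def HoldsRightEnds (G : MultiGraph (Fin n) (Fin m)) (c : Fin n → Fin t) (u : Fin n) (σ : Mem) :
    Prop :=
  ∀ (e : Fin m), σ.arr 8 e ≤ n ∧
    ∀ w : Fin n, σ.arr 8 e = w ↔ w ∈ G.rightNbrs c u ∧ e ∈ G.between u w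

theorem ite_ite_same_cond {α : Type*} {p : Prop} [Decidable p] {a b d : α} :
    (if p then a else if p then b else d) = if p then a else d := by
  split_ifs <;> rfl

theorem rightEnds_spec {σ : Mem} {u : Fin n} (h : HoldsInput G c σ) (hu : σ.var 4 = u) :
    HoldsRightEnds G c u (rightEnds.run O σ) := by
  have key := Prog.run_loop_induct (O := O) (σ := σ) (prog := rightEnds) rfl
    (fun k τ => ∀ e : Fin m, (e : ℕ) < k → τ.arr 8 e ≤ n ∧
      ∀ w : Fin n, τ.arr 8 e = w ↔ w ∈ G.rightNbrs c u ∧ e ∈ G.between u w) (by simp) ?_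
  · intro e
    refine key e ?_
    simp [Expr.eval, h.numEdges]
  · intro k τ hk hv ha hI
    have h0 : τ.arr 0 = σ.arr 0 := ha 0 rfl
    have h1 : τ.arr 1 = σ.arr 1 := ha 1 rfl
    have h2 : τ.arr 2 = σ.arr 2 := ha 2 rfl
    have hv0 : τ.var 0 = n := (hv 0 rfl).trans h.numVertices
    have hv4 : τ.var 4 = u := (hv 4 rfl).trans hu
    rw [Expr.eval, h.numEdges] at hk
    obtain ⟨x, y, hxy, hx, hy⟩ := h.endpoints ⟨k, hk⟩
    have hR : ∀ w, w ∈ G.rightNbrs c u ∧ ⟨k, hk⟩ ∈ G.between u w ↔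
        (x = u ∧ w = y ∨ y = u ∧ w = x) ∧ c u < c w := by
      intro w
      rw [MultiGraph.mem_rightNbrs, MultiGraph.mem_between, hxy]
      constructor
      · rintro ⟨⟨-, h1⟩, h2⟩
        refine ⟨?_, h1⟩
        rcases Sym2.eq_iff.1 h2 with h | h <;> tauto
      · rintro ⟨⟨rfl, rfl⟩ | ⟨rfl, rfl⟩, h1⟩
        · exact ⟨⟨⟨_, hxy⟩, h1⟩, rfl⟩
        · exact ⟨⟨⟨_, hxy.trans Sym2.eq_swap⟩, h1⟩, Sym2.eq_swap⟩
    have hR' : ∀ e : Fin m, (e : ℕ) = k → ∀ w, w ∈ G.rightNbrs c u ∧ e ∈ G.between u w ↔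
        (x = u ∧ w = y ∨ y = u ∧ w = x) ∧ c u < c w := by
      rintro e rfl; exact hR
    clear hR
    have hcx := h.colours x
    have hcy := h.colours y
    have hcu := h.colours u
    have hxy' : x ≠ y := fun h => G.loopless ⟨k, hk⟩
      (by rw [hxy, h]; exact Sym2.mk_isDiag_iff.2 rfl)
    simp only at hx hy
    simp only [Prog.wp_seq, Prog.wp_setArr, Prog.wp_ifEq, Prog.wp_ifLt, Expr.eval, Mem.setVar_var,
      Mem.setVar_arr, Mem.setArr_var, Mem.setArr_arr, h0, h1, h2, hv0, hv4, if_true,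
      Nat.reduceEqDiff, if_false, hx, hy, hcx, hcy, hcu]
    have e1 : ∀ x y : Fin n, ((x : ℕ) = y) = (x = y) := fun x y => propext Fin.ext_iff.symm
    -- A round writes cell `k` only, so it remains to check the value finally written there in each
    -- branch.
    have key : ∀ val, (val ≤ n ∧ ∀ w : Fin n, val = w ↔ (x = u ∧ w = y ∨ y = u ∧ w = x) ∧ c u < c w) →
        ∀ e : Fin m, (e : ℕ) < k + 1 → (if (e : ℕ) = k then val else τ.arr 8 e) ≤ n ∧
          ∀ w : Fin n, (if (e : ℕ) = k then val else τ.arr 8 e) = w ↔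
            w ∈ G.rightNbrs c u ∧ e ∈ G.between u w := by
      intro val hval e he
      by_cases hek : (e : ℕ) = k
      · simp only [hek, if_true, hR' e hek]
        exact hval
      · simp only [hek, if_false]
        exact hI e (by omega)
    have hxn := x.isLt
    have hyn := y.isLt
    have hn : ∀ w : Fin n, n ≠ w := fun w => w.isLt.ne'
    simp only [ite_ite_same_cond, e1, Fin.val_fin_lt]
    refine ⟨fun h1 => ⟨fun h2 => ⟨fun h3 => absurd (h1.trans h3.symm) hxy', fun h3 => ?_⟩,
      fun h2 => ⟨fun h3 => absurd (h1.trans h3.symm) hxy', fun h3 => ?_⟩⟩,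
      fun h1 => ⟨fun h2 => ⟨fun h3 => ?_, fun h3 => ?_⟩, fun h2 => ?_⟩⟩
    all_goals
      refine key _ ⟨by omega, fun w => ?_⟩
      simp only [e1, hn, false_iff]
      grind

end TheProgram

/-! ### Correctness of the greedy cuts -/

section CutSpec

variable {O : ℕ → (ℕ → ℕ) → ℕ} {n m : ℕ}

theorem Mem.setArr_arr_self {σ : Mem} {a i k j : ℕ} :
    (σ.setArr a i k).arr a j = if j = i then k else σ.arr a j := by
  simp [Mem.setArr_arr]

theorem Mem.setArr_arr_of_ne {σ : Mem} {a i k b : ℕ} (h : b ≠ a) :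
    (σ.setArr a i k).arr b = σ.arr b := by
  funext j
  simp [Mem.setArr_arr, h]

theorem bundleOf_setArr {σ : Mem} {a : ℕ} {e : Fin m} :
    bundleOf m ((σ.setArr a e 1).arr a) = insert e (bundleOf m (σ.arr a)) := by
  ext x
  simp only [mem_bundleOf, Finset.mem_insert, Mem.setArr_arr_self, Fin.ext_iff]
  split_ifs <;> simp [*]

theorem bundleOf_eq_empty {a : ℕ → ℕ} (h : ∀ e : Fin m, a e = 0) : bundleOf m a = ∅ := by
  ext x
  simp [mem_bundleOf, h]

theorem clearParts_spec {σ : Mem} (hm : σ.var 1 = m) :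
    bundleOf m ((clearParts.run O σ).arr 4) = ∅ ∧ bundleOf m ((clearParts.run O σ).arr 5) = ∅ ∧
      (1 ≤ (clearParts.run O σ).var 17 ↔ ∃ e : Fin m, σ.arr 8 e = σ.var 5) := by
  have key := Prog.run_loop_induct (O := O) (σ := σ.setVar 17 0) (prog := clearLoop) rfl
    (fun k τ => (∀ e : Fin m, (e : ℕ) < k → τ.arr 4 e = 0 ∧ τ.arr 5 e = 0) ∧
      (1 ≤ τ.var 17 ↔ ∃ e : Fin m, (e : ℕ) < k ∧ σ.arr 8 e = σ.var 5))
    (by simp [Mem.setVar_var]) ?_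
  · have e : Expr.eval (σ.setVar 17 0) (.var 1) = m := by simp [Expr.eval, Mem.setVar_var, hm]
    rw [e] at key
    refine ⟨bundleOf_eq_empty fun e => (key.1 e e.isLt).1,
      bundleOf_eq_empty fun e => (key.1 e e.isLt).2, key.2.trans ?_⟩
    simp
  · rintro k τ hk hv ha ⟨hI, hf⟩
    simp only [Expr.eval, Mem.setVar_var, hm, Nat.reduceEqDiff, if_false] at hk
    have h8 : τ.arr 8 = σ.arr 8 := ha 8 rfl
    have h5 : τ.var 5 = σ.var 5 := hv 5 rfl
    simp only [Prog.wp_seq, Prog.wp_setArr, Prog.wp_setVar, Prog.wp_ifEq, Expr.eval,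
      Mem.setVar_var, Mem.setVar_arr, Mem.setArr_var, Mem.setArr_arr, if_true, Nat.reduceEqDiff,
      if_false, h8, h5]
    have hex : (∃ e : Fin m, (e : ℕ) < k + 1 ∧ σ.arr 8 e = σ.var 5) ↔
        (∃ e : Fin m, (e : ℕ) < k ∧ σ.arr 8 e = σ.var 5) ∨ σ.arr 8 k = σ.var 5 := by
      constructor
      · rintro ⟨e, he, h⟩
        rcases Nat.lt_succ_iff_lt_or_eq.1 he with he | rfl
        · exact Or.inl ⟨e, he, h⟩
        · exact Or.inr h
      · rintro (⟨e, he, h⟩ | h)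
        · exact ⟨e, by omega, h⟩
        · exact ⟨⟨k, hk⟩, by simp, h⟩
    rw [hex, ← hf]
    refine ⟨fun h => ⟨fun e he => ?_, ?_⟩, fun h => ⟨fun e he => ?_, ?_⟩⟩
    · have := hI e
      grind
    · simp [h]
    · have := hI e
      grind
    · simp [h]

/-- Because variable `9` is one more than the best value so far, the test `≤` of the program is a
strict comparison, and the initial zero lets any candidate through. Array `6` serves as the
indicator of a singleton and is cleared after each query. -/
theorem selectBest_spec {σ : Mem} {w : Fin n} (v : Fin n → Finset (Fin m) → ℕ) (hm : σ.var 1 = m)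
    (hw : σ.var 5 = w) (h6 : ∀ e : Fin m, σ.arr 6 e = 0) (cand : Fin m → Prop)
    (hcand : ∀ e : Fin m, cand e ↔ σ.arr 8 e = w ∧ σ.arr 4 e = 0 ∧ σ.arr 5 e = 0) (τ : Mem)
    (hτ : selectBest.run (valueOracle v) σ = τ) :
    (∀ e : Fin m, τ.arr 6 e = 0) ∧ ((τ.var 9 = 0 ∧ ∀ e, ¬ cand e) ∨
      ∃ b : Fin m, τ.var 8 = b ∧ cand b ∧ τ.var 9 = v w {b} + 1 ∧
        ∀ e, cand e → v w {e} ≤ v w {b}) := by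
  have key := Prog.run_loop_induct (O := valueOracle v) (σ := σ.setVar 9 0) (prog := selectLoop) rfl
    (fun k τ => (∀ e : Fin m, τ.arr 6 e = 0) ∧
      ((τ.var 9 = 0 ∧ ∀ e : Fin m, (e : ℕ) < k → ¬ cand e) ∨
      ∃ b : Fin m, τ.var 8 = b ∧ cand b ∧ τ.var 9 = v w {b} + 1 ∧
        ∀ e : Fin m, (e : ℕ) < k → cand e → v w {e} ≤ v w {b}))
    ⟨h6, Or.inl (by simp [Mem.setVar_var])⟩ ?_
  · have e : Expr.eval (σ.setVar 9 0) (.var 1) = m := by simp [Expr.eval, Mem.setVar_var, hm]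
    rw [e, show selectLoop.run (valueOracle v) (σ.setVar 9 0) = τ from hτ] at key
    simpa using key
  · rintro k τ hk hv ha ⟨hI, hf⟩
    simp only [Expr.eval, Mem.setVar_var, hm, Nat.reduceEqDiff, if_false] at hk
    have h8 : τ.arr 8 = σ.arr 8 := ha 8 rfl
    have h4 : τ.arr 4 = σ.arr 4 := ha 4 rfl
    have h5' : τ.arr 5 = σ.arr 5 := ha 5 rfl
    have h5 : τ.var 5 = w := (hv 5 rfl).trans hw
    have hq : valueOracle v w (((τ.setVar 7 k).setArr 6 k 1).arr 6) = v w {⟨k, hk⟩} := by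
      rw [valueOracle_eq]
      congr 1
      have := bundleOf_setArr (σ := τ.setVar 7 k) (a := 6) (e := (⟨k, hk⟩ : Fin m))
      rw [this, Mem.setVar_arr, bundleOf_eq_empty hI]
      rfl
    have hlast : ∀ p : Fin m → Prop, (∀ e : Fin m, (e : ℕ) < k + 1 → p e) ↔
        (∀ e : Fin m, (e : ℕ) < k → p e) ∧ p ⟨k, hk⟩ := by
      intro p
      constructor
      · exact fun h => ⟨fun e he => h e (by omega), h _ (by simp)⟩
      · rintro ⟨h1, h2⟩ e he
        rcases Nat.lt_succ_iff_lt_or_eq.1 he with he | he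
        · exact h1 e he
        · obtain rfl : e = ⟨k, hk⟩ := Fin.ext he
          exact h2
    have hck := hcand ⟨k, hk⟩
    simp only at hck
    simp only [Prog.wp_seq, Prog.wp_setArr, Prog.wp_setVar, Prog.wp_ifEq, Prog.wp_ifLe,
      Prog.wp_query, Prog.wp_skip, Expr.eval, hlast,
      Mem.setVar_var, Mem.setVar_arr, Mem.setArr_var, Mem.setArr_arr, if_true, Nat.reduceEqDiff,
      if_false, h8, h5, h4, h5', hq, ite_ite_same_cond, hI]
    simp only [true_and, implies_true, Nat.le_zero, ite_self]
    have hskip : ¬ cand ⟨k, hk⟩ →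
        (τ.var 9 = 0 ∧ (∀ e : Fin m, (e : ℕ) < k → ¬ cand e) ∧ ¬ cand ⟨k, hk⟩) ∨
        ∃ b : Fin m, τ.var 8 = b ∧ cand b ∧ τ.var 9 = v w {b} + 1 ∧
          (∀ e : Fin m, (e : ℕ) < k → cand e → v w {e} ≤ v w {b}) ∧
          (cand ⟨k, hk⟩ → v w {⟨k, hk⟩} ≤ v w {b}) := by
      intro hc
      rcases hf with ⟨h1, h2⟩ | ⟨b, h1, h2, h3, h4⟩
      · exact Or.inl ⟨h1, h2, hc⟩
      · exact Or.inr ⟨b, h1, h2, h3, h4, fun h => absurd h hc⟩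
    refine ⟨fun h1 => ⟨fun h2 => ⟨fun h3 => ⟨fun h4 => Or.inr ?_, fun h4 => Or.inr ?_⟩,
      fun h3 => hskip ?_⟩, fun h2 => hskip ?_⟩, fun h1 => hskip ?_⟩
    · refine ⟨⟨k, hk⟩, rfl, hck.2 ⟨h1, h2, h3⟩, rfl, fun e he hc => ?_, fun _ => le_rfl⟩
      rcases hf with ⟨-, h6⟩ | ⟨b, -, -, h7, h8⟩
      · exact absurd hc (h6 e he)
      · have := h8 e he hc
        omega
    · rcases hf with ⟨h5, -⟩ | ⟨b, h5, h6, h7, h8⟩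
      · omega
      · exact ⟨b, h5, h6, h7, h8, fun _ => by omega⟩
    · rw [hck]; omega
    · rw [hck]; omega
    · rw [hck]; tauto

/-- Goods are placed by decreasing value, so each new good has least value among those placed and
`IsCut.insert_left` applies. Every round places a good while there is one left, so as many rounds as
there are edges suffice. -/
theorem cutEdges_spec {σ : Mem} {w : Fin n} {v : Fin n → Finset (Fin m) → ℕ}
    (hv : IsCancellable (v w)) (hm : σ.var 1 = m)
    (hw : σ.var 5 = w) (h6 : ∀ e : Fin m, σ.arr 6 e = 0) (h4 : bundleOf m (σ.arr 4) = ∅)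
    (h5 : bundleOf m (σ.arr 5) = ∅) {B : Finset (Fin m)} (hB : ∀ e : Fin m, e ∈ B ↔ σ.arr 8 e = w)
    (τ : Mem) (hτ : cutEdges.run (valueOracle v) σ = τ) :
    (∀ e : Fin m, τ.arr 6 e = 0) ∧
      IsCut (v w) B (bundleOf m (τ.arr 4)) (bundleOf m (τ.arr 5)) := by
  have key := Prog.run_loop_induct (O := valueOracle v) (σ := σ) (prog := cutEdges) rfl
    (fun k τ => (∀ e : Fin m, τ.arr 6 e = 0) ∧ ∃ P Q, bundleOf m (τ.arr 4) = P ∧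
      bundleOf m (τ.arr 5) = Q ∧ IsCut (v w) (P ∪ Q) P Q ∧ P ∪ Q ⊆ B ∧
      (∀ x ∈ P ∪ Q, ∀ y ∈ B, y ∉ P ∪ Q → v w {y} ≤ v w {x}) ∧
      (B ⊆ P ∪ Q ∨ k ≤ (P ∪ Q).card))
    ⟨h6, ∅, ∅, h4, h5, by simpa using isCut_empty, by simp, by simp, by simp⟩ ?_
  · rw [hτ, Expr.eval, hm] at key
    obtain ⟨h6', P, Q, rfl, rfl, hcut, hsub, -, hk⟩ := key
    refine ⟨h6', ?_⟩
    have : B ⊆ bundleOf m (τ.arr 4) ∪ bundleOf m (τ.arr 5) := by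
      rcases hk with h | h
      · exact h
      · have : bundleOf m (τ.arr 4) ∪ bundleOf m (τ.arr 5) = Finset.univ := by
          rw [← Finset.card_eq_iff_eq_univ]
          exact le_antisymm (Finset.card_le_univ _) (by simpa using h)
        rw [this]
        exact Finset.subset_univ _
    rwa [hsub.antisymm this] at hcut
  · rintro k τ hk hvr har ⟨hI, P, Q, hP, hQ, hcut, hsub, hle, hcard⟩
    rw [Prog.wp_seq]
    have hsel := selectBest_spec (σ := τ.setVar 6 k) v
      (by rw [Mem.setVar_var_of_ne (by omega), hvr 1 rfl, hm])
      (by rw [Mem.setVar_var_of_ne (by omega), hvr 5 rfl, hw]) hI (fun e => e ∈ B ∧ e ∉ P ∪ Q)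
      (fun e => by
        rw [Mem.setVar_arr, har 8 rfl, hB, Finset.mem_union, ← hP, ← hQ, mem_bundleOf, mem_bundleOf]
        tauto) _ rfl
    rw [Prog.wp_iff]
    have h4 : (selectBest.run (valueOracle v) (τ.setVar 6 k)).arr 4 = τ.arr 4 := Prog.run_arr rfl _
    have h5 : (selectBest.run (valueOracle v) (τ.setVar 6 k)).arr 5 = τ.arr 5 := Prog.run_arr rfl _
    have h5v : (selectBest.run (valueOracle v) (τ.setVar 6 k)).var 5 = w := by
      rw [Prog.run_var rfl, Mem.setVar_var_of_ne (by omega), hvr 5 rfl, hw]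
    generalize selectBest.run (valueOracle v) (τ.setVar 6 k) = ρ at *
    rw [← h4] at hP
    rw [← h5] at hQ
    obtain ⟨hρ6, ⟨h9, hnone⟩ | ⟨b, h8, hb, h9, hmax⟩⟩ := hsel
    · simp only [placeBest, Prog.wp_ifLe, Prog.wp_skip, Expr.eval, h9]
      refine ⟨fun h => absurd h (by omega), fun _ => ⟨hρ6, P, Q, hP, hQ, hcut, hsub, hle, Or.inl ?_⟩⟩
      intro e he
      by_contra hne
      exact hnone e ⟨he, hne⟩
    · have hqP : valueOracle v w (ρ.arr 4) = v w P := by rw [valueOracle_eq, hP]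
      have hqQ : valueOracle v w (ρ.arr 5) = v w Q := by rw [valueOracle_eq, hQ]
      have hsub' : insert b (P ∪ Q) ⊆ B := Finset.insert_subset hb.1 hsub
      have hle' : ∀ x ∈ insert b (P ∪ Q), ∀ y ∈ B, y ∉ insert b (P ∪ Q) → v w {y} ≤ v w {x} := by
        intro x hx y hy hyn
        rw [Finset.mem_insert, not_or] at hyn
        rcases Finset.mem_insert.1 hx with rfl | hx
        · exact hmax y ⟨hy, hyn.2⟩
        · exact hle x hx y hy hyn.2
      have hcard' : B ⊆ insert b (P ∪ Q) ∨ k + 1 ≤ (insert b (P ∪ Q)).card := by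
        refine hcard.imp (fun h => h.trans (Finset.subset_insert _ _)) fun h => ?_
        rw [Finset.card_insert_of_notMem hb.2]
        omega
      have hmin : ∀ x ∈ P ∪ Q, v w {b} ≤ v w {x} := fun x hx => hle x hx b hb.1 hb.2
      simp only [placeBest, Prog.wp_seq, Prog.wp_ifLe, Prog.wp_setArr, Prog.wp_query, Expr.eval,
        Prog.wp_skip, Mem.setVar_var, Mem.setVar_arr, Nat.reduceEqDiff, if_false, if_true,
        h9, h5v, h8, hqP, hqQ]
      refine ⟨fun _ => ⟨fun h => ⟨fun e => ?_, insert b P, Q, ?_, ?_, ?_⟩,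
        fun h => ⟨fun e => ?_, P, insert b Q, ?_, ?_, ?_⟩⟩, fun h => absurd h (by omega)⟩
      · rw [Mem.setArr_arr_of_ne (by omega)]
        exact hρ6 e
      · rw [bundleOf_setArr, Mem.setVar_arr, Mem.setVar_arr, hP]
      · rw [Mem.setArr_arr_of_ne (by omega)]
        exact hQ
      · rw [Finset.insert_union]
        exact ⟨hcut.insert_left hv hb.2 hmin h, hsub', hle', hcard'⟩
      · rw [Mem.setArr_arr_of_ne (by omega)]
        exact hρ6 e
      · rw [Mem.setArr_arr_of_ne (by omega)]
        exact hP
      · rw [bundleOf_setArr, Mem.setVar_arr, Mem.setVar_arr, hQ]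
      · rw [Finset.union_insert]
        refine ⟨?_, hsub', hle', hcard'⟩
        refine (IsCut.insert_left hv hcut.symm hb.2 hmin h.le).symm

end CutSpec

/-! ### Correctness of the treatment of a neighbour and of the redistribution loops -/

section NbrSpec

variable {O : ℕ → (ℕ → ℕ) → ℕ} {n m : ℕ}

theorem preferParts_spec {σ : Mem} {u w : Fin n} {v : Fin n → Finset (Fin m) → ℕ}
    (hu : σ.var 4 = u) (hw : σ.var 5 = w) {P Q : Finset (Fin m)} (hP : bundleOf m (σ.arr 4) = P)
    (hQ : bundleOf m (σ.arr 5) = Q) (hPQ : P ≠ Q) :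
    preferParts.wp (valueOracle v) (fun τ =>
      ∃ S T, IsPreferred (v u) P Q S ∧ IsPreferred (v w) P Q T ∧
        (v u P = v u Q ∨ v w P = v w Q → S ≠ T) ∧ τ.var 10 = v u S ∧ (1 ≤ τ.var 18 ↔ S = T) ∧
        (τ.var 19 ≤ 0 → T = P) ∧ (0 < τ.var 19 → T = Q)) σ := by
  simp only [preferParts, Prog.wp_seq, Prog.wp_ifLe, Prog.wp_setVar, Prog.wp_query, Expr.eval,
    Mem.setVar_var, Mem.setVar_arr, Nat.reduceEqDiff, if_false, if_true, hu, hw, valueOracle_eq,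
    hP, hQ]
  unfold IsPreferred
  refine ⟨fun h1 => ⟨fun h2 => ⟨P, Q, ?_⟩, fun h2 => ⟨fun h3 => ⟨Q, P, ?_⟩, fun h3 => ⟨P, P, ?_⟩⟩⟩,
    fun h1 => ⟨fun h2 => ⟨Q, P, ?_⟩, fun h2 => ⟨Q, Q, ?_⟩⟩⟩
  · simp [h1, h2, hPQ]
  -- Here `u` is indifferent and gives way to `w`; variable `10` still holds the value of `P`, which
  -- equals that of `Q`.
  · simp [h2.le, h1.antisymm h3, hPQ.symm]
  · simp [h1, h2.le, h2.ne', h3.ne']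
  · simp [h1.le, h2, hPQ.symm]
  · simp [h1.le, h2.le, h1.ne, h2.ne]

theorem recordPart_spec {σ : Mem} (hm : σ.var 1 = m) (e : Fin m) :
    (recordPart.run O σ).arr 7 e = if σ.arr 8 e = σ.var 5 then
      (if σ.var 19 ≤ 0 then σ.arr 4 e else σ.arr 5 e) else σ.arr 7 e := by
  have key := Prog.run_loop_induct (O := O) (σ := σ) (prog := recordPart) rfl
    (fun k τ => ∀ e : Fin m, τ.arr 7 e = if (e : ℕ) < k ∧ σ.arr 8 e = σ.var 5 then
      (if σ.var 19 ≤ 0 then σ.arr 4 e else σ.arr 5 e) else σ.arr 7 e) (by simp) ?_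
  · rw [Expr.eval, hm] at key
    simpa using key e
  · intro k τ hk hv ha hI
    have h8 : τ.arr 8 = σ.arr 8 := ha 8 rfl
    have h4 : τ.arr 4 = σ.arr 4 := ha 4 rfl
    have h5' : τ.arr 5 = σ.arr 5 := ha 5 rfl
    have h5 : τ.var 5 = σ.var 5 := hv 5 rfl
    have h19 : τ.var 19 = σ.var 19 := hv 19 rfl
    simp only [Prog.wp_setArr, Prog.wp_ifEq, Prog.wp_ifLe, Expr.eval, Mem.setVar_var,
      Mem.setVar_arr, Mem.setArr_arr, if_true, Nat.reduceEqDiff, if_false, h8, h5, h4, h5', h19, hI]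
    refine ⟨fun h1 => ⟨fun h2 e => ?_, fun h2 e => ?_⟩, fun h1 e => ?_⟩ <;> grind

theorem handOut_spec {σ : Mem} (hn : σ.var 0 = n) (hm : σ.var 1 = m) (e : Fin m) :
    (handOut.run O σ).arr 3 e = if σ.arr 8 e < n then
      (if σ.arr 7 e ≤ 0 then σ.var 4 else σ.arr 8 e) else σ.arr 3 e := by
  have key := Prog.run_loop_induct (O := O) (σ := σ) (prog := handOut) rfl
    (fun k τ => ∀ e : Fin m, τ.arr 3 e = if (e : ℕ) < k ∧ σ.arr 8 e < n then
      (if σ.arr 7 e ≤ 0 then σ.var 4 else σ.arr 8 e) else σ.arr 3 e) (by simp) ?_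
  · rw [Expr.eval, hm] at key
    simpa using key e
  · intro k τ hk hv ha hI
    have h8 : τ.arr 8 = σ.arr 8 := ha 8 rfl
    have h7 : τ.arr 7 = σ.arr 7 := ha 7 rfl
    have h4 : τ.var 4 = σ.var 4 := hv 4 rfl
    have h0 : τ.var 0 = n := (hv 0 rfl).trans hn
    simp only [Prog.wp_setArr, Prog.wp_ifLt, Prog.wp_ifLe, Expr.eval, Mem.setVar_var,
      Mem.setVar_arr, Mem.setArr_arr, if_true, Nat.reduceEqDiff, if_false, h8, h7, h4, h0, hI]
    refine ⟨fun h1 => ⟨fun h2 e => ?_, fun h2 e => ?_⟩, fun h1 e => ?_⟩ <;> grind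

theorem compareBundles_spec {σ : Mem} (hm : σ.var 1 = m) (e : Fin m) :
    (compareBundles.run O σ).arr 9 e = (if σ.arr 3 e = σ.var 4 then 1 else 0) ∧
    (compareBundles.run O σ).arr 10 e = if σ.arr 8 e = σ.var 15 then σ.arr 7 e else 0 := by
  have key := Prog.run_loop_induct (O := O) (σ := σ) (prog := compareBundles) rfl
    (fun k τ => ∀ e : Fin m, (e : ℕ) < k → τ.arr 9 e = (if σ.arr 3 e = σ.var 4 then 1 else 0) ∧
      τ.arr 10 e = if σ.arr 8 e = σ.var 15 then σ.arr 7 e else 0) (by simp) ?_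
  · rw [Expr.eval, hm] at key
    exact key e e.isLt
  · intro k τ hk hv ha hI
    have h8 : τ.arr 8 = σ.arr 8 := ha 8 rfl
    have h7 : τ.arr 7 = σ.arr 7 := ha 7 rfl
    have h3 : τ.arr 3 = σ.arr 3 := ha 3 rfl
    have h4 : τ.var 4 = σ.var 4 := hv 4 rfl
    have h15 : τ.var 15 = σ.var 15 := hv 15 rfl
    simp only [Prog.wp_seq, Prog.wp_setArr, Prog.wp_ifEq, Expr.eval, Mem.setVar_var,
      Mem.setVar_arr, Mem.setArr_var, Mem.setArr_arr, if_true, Nat.reduceEqDiff, if_false,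
      h8, h7, h3, h4, h15, ite_ite_same_cond]
    refine ⟨fun h1 => ⟨fun h2 e he => ?_, fun h2 e he => ?_⟩,
      fun h1 => ⟨fun h2 e he => ?_, fun h2 e he => ?_⟩⟩
    all_goals
      have := hI e
      grind

theorem exchange_spec {σ : Mem} (hm : σ.var 1 = m) (e : Fin m) :
    (exchange.run O σ).arr 3 e = if 1 ≤ σ.arr 10 e then σ.var 4 else
      if 1 ≤ σ.arr 9 e then σ.var 15 else σ.arr 3 e := by
  have key := Prog.run_loop_induct (O := O) (σ := σ) (prog := exchange) rfl
    (fun k τ => ∀ e : Fin m, τ.arr 3 e = if (e : ℕ) < k then (if 1 ≤ σ.arr 10 e then σ.var 4 else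
      if 1 ≤ σ.arr 9 e then σ.var 15 else σ.arr 3 e) else σ.arr 3 e) (by simp) ?_
  · rw [Expr.eval, hm] at key
    simpa using key e
  · intro k τ hk hv ha hI
    have h9 : τ.arr 9 = σ.arr 9 := ha 9 rfl
    have h10 : τ.arr 10 = σ.arr 10 := ha 10 rfl
    have h4 : τ.var 4 = σ.var 4 := hv 4 rfl
    have h15 : τ.var 15 = σ.var 15 := hv 15 rfl
    simp only [Prog.wp_seq, Prog.wp_setArr, Prog.wp_ifLe, Prog.wp_skip, Expr.eval, Mem.setVar_var,
      Mem.setVar_arr, Mem.setArr_var, Mem.setArr_arr, if_true, Nat.reduceEqDiff, if_false,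
      h9, h10, h4, h15, ite_ite_same_cond, hI]
    refine ⟨fun h1 => ⟨fun h2 e => ?_, fun h2 e => ?_⟩,
      fun h1 => ⟨fun h2 e => ?_, fun h2 e => ?_⟩⟩ <;> grind

variable {t : ℕ} {G : MultiGraph (Fin n) (Fin m)} {c : Fin n → Fin t}

/-- The effect of `treatNbr`. -/
theorem treatNbr_spec {σ : Mem} {u w : Fin n} {v : Fin n → Finset (Fin m) → ℕ}
    (hv : ∀ w, IsCancellable (v w)) (hm : σ.var 1 = m) (hu : σ.var 4 = u) (hw : σ.var 5 = w)
    (h8 : HoldsRightEnds G c u σ) (h6 : ∀ e : Fin m, σ.arr 6 e = 0) :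
    treatNbr.wp (valueOracle v) (fun τ => (∀ e : Fin m, τ.arr 6 e = 0) ∧
      ((w ∉ G.rightNbrs c u ∧ τ.arr 7 = σ.arr 7 ∧ τ.var 14 = σ.var 14 ∧ τ.var 15 = σ.var 15 ∧
        τ.var 16 = σ.var 16) ∨
      (w ∈ G.rightNbrs c u ∧ ∃ S T, (∃ P Q, IsCut (v w) (G.between u w) P Q ∧
        IsPreferred (v u) P Q S ∧ IsPreferred (v w) P Q T ∧
        (v u P = v u Q ∨ v w P = v w Q → S ≠ T)) ∧
        (∀ e ∈ G.between u w, e ∈ T ↔ τ.arr 7 e ≠ 0) ∧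
        (∀ e ∉ G.between u w, τ.arr 7 e = σ.arr 7 e) ∧
        (σ.var 14 ≤ v u S ∧ τ.var 14 = v u S + 1 ∧ τ.var 15 = w ∧ (1 ≤ τ.var 16 ↔ S = T) ∨
          v u S < σ.var 14 ∧ τ.var 14 = σ.var 14 ∧ τ.var 15 = σ.var 15 ∧
          τ.var 16 = σ.var 16)))) σ := by
  rw [treatNbr, Prog.wp_seq, Prog.wp_iff]
  obtain ⟨h4e, h5e, h17⟩ := clearParts_spec (O := valueOracle v) hm
  have k8 : (clearParts.run (valueOracle v) σ).arr 8 = σ.arr 8 := Prog.run_arr rfl _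
  have k7 : (clearParts.run (valueOracle v) σ).arr 7 = σ.arr 7 := Prog.run_arr rfl _
  have k6 : (clearParts.run (valueOracle v) σ).arr 6 = σ.arr 6 := Prog.run_arr rfl _
  have kv1 : (clearParts.run (valueOracle v) σ).var 1 = σ.var 1 := Prog.run_var rfl _
  have kv4 : (clearParts.run (valueOracle v) σ).var 4 = σ.var 4 := Prog.run_var rfl _
  have kv5 : (clearParts.run (valueOracle v) σ).var 5 = σ.var 5 := Prog.run_var rfl _
  have kv14 : (clearParts.run (valueOracle v) σ).var 14 = σ.var 14 := Prog.run_var rfl _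
  have kv15 : (clearParts.run (valueOracle v) σ).var 15 = σ.var 15 := Prog.run_var rfl _
  have kv16 : (clearParts.run (valueOracle v) σ).var 16 = σ.var 16 := Prog.run_var rfl _
  generalize clearParts.run (valueOracle v) σ = σ₁ at *
  have hnbr : w ∈ G.rightNbrs c u ↔ 1 ≤ σ₁.var 17 := by
    rw [h17, hw]
    constructor
    · intro h
      obtain ⟨e, he⟩ := MultiGraph.between_nonempty h
      exact ⟨e, ((h8 e).2 w).2 ⟨h, he⟩⟩
    · rintro ⟨e, he⟩
      exact (((h8 e).2 w).1 he).1
  rw [Prog.wp_ifLe]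
  simp only [Expr.eval]
  refine ⟨fun h => ?_, fun h => ?_⟩
  swap
  · rw [Prog.wp_skip]
    refine ⟨fun e => by rw [k6, h6], Or.inl ⟨by rw [hnbr]; omega, k7, kv14, kv15, kv16⟩⟩
  have hwN := hnbr.2 h
  have hB : ∀ e : Fin m, e ∈ G.between u w ↔ σ.arr 8 e = w := fun e => by
    rw [(h8 e).2 w]
    simp [hwN]
  rw [Prog.wp_seq, Prog.wp_iff]
  obtain ⟨c6, hcut⟩ := cutEdges_spec (σ := σ₁) (hv w) (kv1.trans hm) (kv5.trans hw)
    (fun e => by rw [k6, h6]) h4e h5e (B := G.between u w) (fun e => by rw [hB, k8]) _ rfl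
  have c8 : (cutEdges.run (valueOracle v) σ₁).arr 8 = σ.arr 8 := (Prog.run_arr rfl _).trans k8
  have c7 : (cutEdges.run (valueOracle v) σ₁).arr 7 = σ.arr 7 := (Prog.run_arr rfl _).trans k7
  have cv1 : (cutEdges.run (valueOracle v) σ₁).var 1 = m := (Prog.run_var rfl _).trans (kv1.trans hm)
  have cv4 : (cutEdges.run (valueOracle v) σ₁).var 4 = u := (Prog.run_var rfl _).trans (kv4.trans hu)
  have cv5 : (cutEdges.run (valueOracle v) σ₁).var 5 = w := (Prog.run_var rfl _).trans (kv5.trans hw)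
  have cv14 : (cutEdges.run (valueOracle v) σ₁).var 14 = σ.var 14 := (Prog.run_var rfl _).trans kv14
  have cv15 : (cutEdges.run (valueOracle v) σ₁).var 15 = σ.var 15 := (Prog.run_var rfl _).trans kv15
  have cv16 : (cutEdges.run (valueOracle v) σ₁).var 16 = σ.var 16 := (Prog.run_var rfl _).trans kv16
  generalize cutEdges.run (valueOracle v) σ₁ = σ₂ at *
  rw [Prog.wp_seq, Prog.wp_iff]
  obtain ⟨S, T, hS, hT, htie, h10, h18, h19, h19'⟩ := preferParts_spec (v := v) cv4 cv5 rfl rfl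
    (hcut.ne (MultiGraph.between_nonempty hwN))
  have d8 : (preferParts.run (valueOracle v) σ₂).arr 8 = σ.arr 8 := (Prog.run_arr rfl _).trans c8
  have d7 : (preferParts.run (valueOracle v) σ₂).arr 7 = σ.arr 7 := (Prog.run_arr rfl _).trans c7
  have d6 : (preferParts.run (valueOracle v) σ₂).arr 6 = σ₂.arr 6 := Prog.run_arr rfl _
  have d4 : (preferParts.run (valueOracle v) σ₂).arr 4 = σ₂.arr 4 := Prog.run_arr rfl _
  have d5 : (preferParts.run (valueOracle v) σ₂).arr 5 = σ₂.arr 5 := Prog.run_arr rfl _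
  have dv1 := (Prog.run_var (c := preferParts) (O := valueOracle v) (y := 1) rfl σ₂).trans cv1
  have dv5 := (Prog.run_var (c := preferParts) (O := valueOracle v) (y := 5) rfl σ₂).trans cv5
  have dv14 := (Prog.run_var (c := preferParts) (O := valueOracle v) (y := 14) rfl σ₂).trans cv14
  have dv15 := (Prog.run_var (c := preferParts) (O := valueOracle v) (y := 15) rfl σ₂).trans cv15
  have dv16 := (Prog.run_var (c := preferParts) (O := valueOracle v) (y := 16) rfl σ₂).trans cv16
  generalize preferParts.run (valueOracle v) σ₂ = σ₃ at *
  rw [Prog.wp_seq, Prog.wp_iff]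
  have h7 := fun e => recordPart_spec (O := valueOracle v) dv1 e
  have e6 := Prog.run_arr (c := recordPart) (O := valueOracle v) (b := 6) rfl σ₃
  have ev5 := (Prog.run_var (c := recordPart) (O := valueOracle v) (y := 5) rfl σ₃).trans dv5
  have ev14 := (Prog.run_var (c := recordPart) (O := valueOracle v) (y := 14) rfl σ₃).trans dv14
  have ev15 := (Prog.run_var (c := recordPart) (O := valueOracle v) (y := 15) rfl σ₃).trans dv15
  have ev16 := (Prog.run_var (c := recordPart) (O := valueOracle v) (y := 16) rfl σ₃).trans dv16
  have ev10 := (Prog.run_var (c := recordPart) (O := valueOracle v) (y := 10) rfl σ₃).trans h10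
  have ev18 := Prog.run_var (c := recordPart) (O := valueOracle v) (y := 18) rfl σ₃
  generalize recordPart.run (valueOracle v) σ₃ = σ₄ at *
  have f6 : ∀ e : Fin m, σ₄.arr 6 e = 0 := fun e => by rw [e6, d6, c6]
  have f7 : ∀ e ∈ G.between u w, e ∈ T ↔ σ₄.arr 7 e ≠ 0 := by
    intro e he
    rw [h7, d8, dv5, if_pos ((hB e).1 he)]
    split_ifs with h0
    · rw [h19 h0, mem_bundleOf, d4]
    · rw [h19' (by omega), mem_bundleOf, d5]
  have f7' : ∀ e ∉ G.between u w, σ₄.arr 7 e = σ.arr 7 e := by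
    intro e he
    rw [h7, d8, dv5, if_neg fun h => he ((hB e).2 h), d7]
  rw [← ev18] at h18
  have hcuts : ∃ P Q, IsCut (v w) (G.between u w) P Q ∧ IsPreferred (v u) P Q S ∧
      IsPreferred (v w) P Q T ∧ (v u P = v u Q ∨ v w P = v w Q → S ≠ T) :=
    ⟨_, _, hcut, hS, hT, htie⟩
  simp only [updateFavourite, Prog.wp_seq, Prog.wp_ifLe, Prog.wp_setVar, Prog.wp_skip,
    Expr.eval, Mem.setVar_var, Mem.setVar_arr, Nat.reduceEqDiff, if_false, if_true, ev5, ev10,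
    ev14, ev15, ev16]
  refine ⟨fun h => ⟨f6, Or.inr ⟨hwN, S, T, hcuts, f7, f7', Or.inl ?_⟩⟩,
    fun h => ⟨f6, Or.inr ⟨hwN, S, T, hcuts, f7, f7', Or.inr ?_⟩⟩⟩
  · simp [h, h18]
  · simp [h]

end NbrSpec

/-! ### Correctness of resolving one vertex -/

section ResolveSpec

variable {O : ℕ → (ℕ → ℕ) → ℕ} {n m t : ℕ} {G : MultiGraph (Fin n) (Fin m)} {c : Fin n → Fin t}

theorem HoldsRightEnds.congr {σ τ : Mem} {u : Fin n} (h : HoldsRightEnds G c u σ)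
    (h8 : τ.arr 8 = σ.arr 8) : HoldsRightEnds G c u τ := by
  unfold HoldsRightEnds
  rw [h8]
  exact h

theorem treatNbrs_spec {σ : Mem} {u : Fin n} {v : Fin n → Finset (Fin m) → ℕ}
    (hv : ∀ w, IsCancellable (v w)) (hn : σ.var 0 = n) (hm : σ.var 1 = m) (hu : σ.var 4 = u)
    (h8 : HoldsRightEnds G c u σ) (h6 : ∀ e : Fin m, σ.arr 6 e = 0) :
    treatNbrs.wp (valueOracle v) (fun τ => (∀ e : Fin m, τ.arr 6 e = 0) ∧
      ∃ S T, CutAndPrefer G c v u S T ∧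
        (∀ w ∈ G.rightNbrs c u, ∀ e ∈ G.between u w, e ∈ T w ↔ τ.arr 7 e ≠ 0) ∧
        ((τ.var 16 = 0 ∧ G.rightNbrs c u = ∅) ∨ ∃ f ∈ G.rightNbrs c u, τ.var 15 = f ∧
          (1 ≤ τ.var 16 ↔ S f = T f) ∧ ∀ w ∈ G.rightNbrs c u, v u (S w) ≤ v u (S f))) σ := by
  simp only [treatNbrs, Prog.wp_seq, Prog.wp_setVar, Expr.eval]
  have key := Prog.run_loop_induct (O := valueOracle v) (σ := (σ.setVar 14 0).setVar 16 0)
    (prog := treatLoop) rfl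
    (fun k τ => (∀ e : Fin m, τ.arr 6 e = 0) ∧ ∃ S T : Fin n → Finset (Fin m),
      (∀ w ∈ G.rightNbrs c u, (w : ℕ) < k → ∃ P Q, IsCut (v w) (G.between u w) P Q ∧
        IsPreferred (v u) P Q (S w) ∧ IsPreferred (v w) P Q (T w) ∧
        (v u P = v u Q ∨ v w P = v w Q → S w ≠ T w)) ∧
      (∀ w ∈ G.rightNbrs c u, (w : ℕ) < k → ∀ e ∈ G.between u w, e ∈ T w ↔ τ.arr 7 e ≠ 0) ∧
      ((τ.var 14 = 0 ∧ τ.var 16 = 0 ∧ ∀ w ∈ G.rightNbrs c u, ¬ (w : ℕ) < k) ∨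
        ∃ f ∈ G.rightNbrs c u, (f : ℕ) < k ∧ τ.var 14 = v u (S f) + 1 ∧ τ.var 15 = f ∧
          (1 ≤ τ.var 16 ↔ S f = T f) ∧
          ∀ w ∈ G.rightNbrs c u, (w : ℕ) < k → v u (S w) ≤ v u (S f)))
    ⟨h6, fun _ => ∅, fun _ => ∅, by simp, by simp, Or.inl (by simp [Mem.setVar_var])⟩ ?_
  · have e : Expr.eval ((σ.setVar 14 0).setVar 16 0) (.var 0) = n := by
      simp [Expr.eval, Mem.setVar_var, hn]
    rw [e] at key
    obtain ⟨k6, S, T, hcut, hT, hf⟩ := key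
    refine ⟨k6, S, T, fun w hw => hcut w hw w.isLt, fun w hw => hT w hw w.isLt, ?_⟩
    rcases hf with ⟨-, h1, h2⟩ | ⟨f, h1, -, -, h2, h3, h4⟩
    · exact Or.inl ⟨h1, Finset.eq_empty_of_forall_notMem fun w hw => h2 w hw w.isLt⟩
    · exact Or.inr ⟨f, h1, h2, h3, fun w hw => h4 w hw w.isLt⟩
  · rintro k τ hk hvr har ⟨hI, S, T, hcut, hT, hf⟩
    simp only [Expr.eval, Mem.setVar_var, hn, Nat.reduceEqDiff, if_false] at hk
    have hlt : ∀ w : Fin n, (w : ℕ) < k + 1 → (w : ℕ) < k ∨ w = ⟨k, hk⟩ := fun w hw =>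
      (Nat.lt_succ_iff_lt_or_eq.1 hw).imp id fun h => Fin.ext h
    have hspec := treatNbr_spec (σ := τ.setVar 5 k) (u := u) (w := ⟨k, hk⟩) hv
      (by rw [Mem.setVar_var_of_ne (by omega), hvr 1 rfl]; exact hm)
      (by rw [Mem.setVar_var_of_ne (by omega), hvr 4 rfl]; exact hu)
      (by simp [Mem.setVar_var]) (h8.congr (har 8 rfl)) hI
    rw [Prog.wp_iff] at hspec ⊢
    generalize treatNbr.run (valueOracle v) (τ.setVar 5 k) = ρ at *
    simp only [Mem.setVar_arr, Mem.setVar_var, Nat.reduceEqDiff, if_false] at hspec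
    obtain ⟨k6, ⟨hN, k7, k14, k15, k16⟩ | ⟨hN, S₀, T₀, hcut₀, hT₀, h7, hfav⟩⟩ := hspec
    · have hlt' : ∀ w ∈ G.rightNbrs c u, (w : ℕ) < k + 1 → (w : ℕ) < k := fun w hw hwk =>
        (hlt w hwk).resolve_right fun h => hN (h ▸ hw)
      refine ⟨k6, S, T, fun w hw hwk => hcut w hw (hlt' w hw hwk), fun w hw hwk e he => ?_, ?_⟩
      · rw [k7]
        exact hT w hw (hlt' w hw hwk) e he
      · rw [k14, k15, k16]
        refine hf.imp ?_ ?_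
        · rintro ⟨h1, h2, h3⟩
          exact ⟨h1, h2, fun w hw hwk => h3 w hw (hlt' w hw hwk)⟩
        · rintro ⟨f, h1, h2, h3, h4, h5, h6⟩
          exact ⟨f, h1, by omega, h3, h4, h5, fun w hw hwk => h6 w hw (hlt' w hw hwk)⟩
    · have hne : ∀ w : Fin n, (w : ℕ) < k → w ≠ ⟨k, hk⟩ := fun w hw h => by
        rw [h] at hw
        exact lt_irrefl _ hw
      refine ⟨k6, Function.update S ⟨k, hk⟩ S₀, Function.update T ⟨k, hk⟩ T₀, ?_, ?_, Or.inr ?_⟩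
      · intro w hw hwk
        rcases hlt w hwk with h | rfl
        · simpa only [Function.update_of_ne (hne w h)] using hcut w hw h
        · simpa only [Function.update_self] using hcut₀
      · intro w hw hwk e he
        rcases hlt w hwk with h | rfl
        -- Array `7` changes only on the edges to the current neighbour, so the parts recorded for
        -- earlier neighbours remain.
        · rw [Function.update_of_ne (hne w h), h7 e, hT w hw h e he]
          intro he'
          exact hne w h (rightEdge_unique hw he hN he').2
        · rw [Function.update_self]
          exact hT₀ e he
      · rcases hfav with ⟨h1, h2, h3, h4⟩ | ⟨h1, h2, h3, h4⟩
        · refine ⟨⟨k, hk⟩, hN, by simp, ?_⟩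
          simp only [Function.update_self]
          refine ⟨h2, h3, h4, fun w hw hwk => ?_⟩
          rcases hlt w hwk with h | rfl
          · rw [Function.update_of_ne (hne w h)]
            rcases hf with ⟨-, -, h5⟩ | ⟨f, -, -, h5, -, -, h6⟩
            · exact absurd h (h5 w hw)
            · have := h6 w hw h
              omega
          · rw [Function.update_self]
        · rcases hf with ⟨h5, -, -⟩ | ⟨f, h5, h6, h7, h8, h9, h10⟩
          · omega
          · refine ⟨f, h5, by omega, ?_⟩
            rw [Function.update_of_ne (hne f h6), Function.update_of_ne (hne f h6), h2, h3, h4]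
            refine ⟨h7, h8, h9, fun w hw hwk => ?_⟩
            rcases hlt w hwk with h | rfl
            · rw [Function.update_of_ne (hne w h)]
              exact h10 w hw h
            · rw [Function.update_self]
              omega

theorem CutAndPrefer.subset {v : Fin n → Finset (Fin m) → ℕ} {u w : Fin n}
    {S T : Fin n → Finset (Fin m)} (h : CutAndPrefer G c v u S T) (hw : w ∈ G.rightNbrs c u) :
    T w ⊆ G.between u w := by
  obtain ⟨P, Q, hPQ, -, hT, -⟩ := h w hw
  rw [← hPQ.union]
  rcases hT.1 with h | h <;> rw [h]
  · exact Finset.subset_union_left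
  · exact Finset.subset_union_right

theorem allocOf_handOut {σ : Mem} {u : Fin n} {T : Fin n → Finset (Fin m)} (hn : σ.var 0 = n)
    (hm : σ.var 1 = m) (hu : σ.var 4 = u) (h8 : HoldsRightEnds G c u σ)
    (hsub : ∀ w ∈ G.rightNbrs c u, T w ⊆ G.between u w)
    (hT : ∀ w ∈ G.rightNbrs c u, ∀ e ∈ G.between u w, e ∈ T w ↔ σ.arr 7 e ≠ 0)
    (hun : ∀ z ∈ G.rightNbrs c u, ∀ e ∈ G.between u z, ∀ w, e ∉ allocOf n m σ w) :
    allocOf n m (handOut.run O σ) = keepAlloc G c u T (allocOf n m σ) := by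
  funext w
  ext e
  rw [mem_keepAlloc hsub, mem_allocOf, handOut_spec hn hm, hu]
  by_cases hlt : σ.arr 8 e < n
  · obtain ⟨hz, he⟩ := ((h8 e).2 ⟨_, hlt⟩).1 rfl
    have hTe := hT _ hz e he
    have hune := hun _ hz e he w
    rw [if_pos hlt]
    constructor
    · intro h
      refine Or.inr ⟨_, hz, he, ?_⟩
      split_ifs at h with h0
      · exact Or.inr ⟨fun h' => hTe.1 h' (by omega), (Fin.ext h).symm⟩
      · exact Or.inl ⟨hTe.2 (by omega), (Fin.ext h).symm⟩
    · rintro (h | ⟨z, hz', he', h⟩)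
      · exact absurd h hune
      · obtain rfl := (rightEdge_unique hz he hz' he').2
        rcases h with ⟨h, rfl⟩ | ⟨h, rfl⟩
        · rw [if_neg (by have := hTe.1 h; omega)]
        · rw [if_pos]
          by_contra h'
          exact h (hTe.2 (by omega))
  · rw [if_neg hlt, mem_allocOf]
    refine ⟨Or.inl, ?_⟩
    rintro (h | ⟨z, hz, he, -⟩)
    · exact h
    · exact absurd z.isLt (((h8 e).2 z).2 ⟨hz, he⟩ ▸ hlt)

/-- Handing out has already produced `keepAlloc`; swapping the whole bundle of `u` with `T f` turns
it into `dumpAlloc`. The old bundle of `f` and the parts of the other neighbours are untouched. -/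
theorem allocOf_exchange {σ : Mem} {A : Fin n → Finset (Fin m)} {u f : Fin n}
    {T : Fin n → Finset (Fin m)} (hm : σ.var 1 = m) (hu : σ.var 4 = u) (h15 : σ.var 15 = f)
    (hf : f ∈ G.rightNbrs c u) (hsub : ∀ w ∈ G.rightNbrs c u, T w ⊆ G.between u w)
    (hA : allocOf n m σ = keepAlloc G c u T A)
    (h9 : bundleOf m (σ.arr 9) = allocOf n m σ u) (h10 : bundleOf m (σ.arr 10) = T f)
    (hun : ∀ z ∈ G.rightNbrs c u, ∀ e ∈ G.between u z, ∀ w, e ∉ A w) :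
    allocOf n m (exchange.run O σ) = dumpAlloc G c u f T A := by
  have hfu : f ≠ u := fun h => by
    have := (MultiGraph.mem_rightNbrs.1 hf).2
    rw [h] at this
    exact lt_irrefl _ this
  funext w
  ext e
  have huniq : ∀ w w', e ∈ allocOf n m σ w → e ∈ allocOf n m σ w' → w = w' := fun w w' h h' =>
    Fin.ext ((mem_allocOf.1 h).symm.trans (mem_allocOf.1 h'))
  have h9e : 1 ≤ σ.arr 9 e ↔ e ∈ allocOf n m σ u := by
    rw [← h9, mem_bundleOf]; omega
  have h10e : 1 ≤ σ.arr 10 e ↔ e ∈ T f := by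
    rw [← h10, mem_bundleOf]; omega
  have hmem : e ∈ allocOf n m (exchange.run O σ) w ↔ (e ∈ T f ∧ w = u) ∨
      (e ∉ T f ∧ e ∈ allocOf n m σ u ∧ w = f) ∨
      (e ∉ T f ∧ e ∉ allocOf n m σ u ∧ e ∈ allocOf n m σ w) := by
    rw [mem_allocOf, exchange_spec hm, hu, h15]
    simp only [h9e, h10e]
    have : ∀ x : Fin n, (x : ℕ) = w ↔ w = x := fun x => by rw [Fin.ext_iff, eq_comm]
    split_ifs with h1 h2
    · simp [h1, this]
    · simp [h1, h2, this]
    · simp [h1, h2, mem_allocOf]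
  rw [hmem, mem_dumpAlloc hf hsub]
  have huniq' : ∀ z ∈ G.rightNbrs c u, ∀ z' ∈ G.rightNbrs c u, e ∈ G.between u z →
      e ∈ G.between u z' → z = z' := fun z hz z' hz' h h' => (rightEdge_unique hz h hz' h').2
  have hTf : e ∈ T f → e ∈ G.between u f := fun h => hsub f hf h
  have huN : ∀ z ∈ G.rightNbrs c u, z ≠ u := fun z hz h => by
    have := (MultiGraph.mem_rightNbrs.1 hz).2
    rw [h] at this
    exact lt_irrefl _ this
  simp only [hA, mem_keepAlloc hsub] at huniq ⊢
  by_cases hR : ∃ z ∈ G.rightNbrs c u, e ∈ G.between u z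
  · obtain ⟨z, hz, he⟩ := hR
    have hA' := hun z hz e he
    have hex : ∀ p : Fin n → Prop,
        (∃ z' ∈ G.rightNbrs c u, e ∈ G.between u z' ∧ p z') ↔ p z := fun p =>
      ⟨fun ⟨z', h1, h2, h3⟩ => huniq' z hz z' h1 he h2 ▸ h3, fun h => ⟨z, hz, he, h⟩⟩
    have hzu := huN z hz
    simp only [hex, hA', false_or, false_and, and_false]
    by_cases hzf : z = f
    · subst hzf
      by_cases hTe : e ∈ T z
      · simp [hTe, hfu.symm]
      · simp [hTe]
    · have hTf' : e ∉ T f := fun h => hzf (huniq' z hz f hf he (hTf h))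
      by_cases hTe : e ∈ T z
      · simp [hTe, hTf', hzf, hzu.symm]
      · simp [hTe, hTf']
  · have hR' : ∀ z ∈ G.rightNbrs c u, e ∉ G.between u z := fun z hz he => hR ⟨z, hz, he⟩
    grind

/-- The edges towards right neighbours must be unowned beforehand, since the program overwrites
their owners whereas the algorithm only enlarges bundles at this point. -/
theorem resolve_spec {σ : Mem} {u : Fin n} {v : Fin n → Finset (Fin m) → ℕ}
    (hv : ∀ w, IsCancellable (v w)) (h : HoldsInput G c σ) (hu : σ.var 4 = u)
    (h6 : ∀ e : Fin m, σ.arr 6 e = 0)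
    (hun : ∀ z ∈ G.rightNbrs c u, ∀ e ∈ G.between u z, ∀ w, e ∉ allocOf n m σ w) :
    resolve.wp (valueOracle v) (fun τ => (∀ e : Fin m, τ.arr 6 e = 0) ∧
      Resolves G c v u (allocOf n m σ) (allocOf n m τ)) σ := by
  rw [resolve, Prog.wp_seq, Prog.wp_iff, Prog.wp_seq, Prog.wp_iff]
  have h8 := rightEnds_spec (O := valueOracle v) h hu
  have a6 := Prog.run_arr (c := rightEnds) (O := valueOracle v) (b := 6) rfl σ
  have a3 := Prog.run_arr (c := rightEnds) (O := valueOracle v) (b := 3) rfl σ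
  have av0 := (Prog.run_var (c := rightEnds) (O := valueOracle v) (y := 0) rfl σ).trans
    h.numVertices
  have av1 := (Prog.run_var (c := rightEnds) (O := valueOracle v) (y := 1) rfl σ).trans h.numEdges
  have av4 := (Prog.run_var (c := rightEnds) (O := valueOracle v) (y := 4) rfl σ).trans hu
  generalize rightEnds.run (valueOracle v) σ = σ₁ at *
  have hspec := treatNbrs_spec (v := v) hv av0 av1 av4 h8 (fun e => by rw [a6, h6])
  rw [Prog.wp_iff] at hspec
  have b3 := (Prog.run_arr (c := treatNbrs) (O := valueOracle v) (b := 3) rfl σ₁).trans a3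
  have b8 := h8.congr (Prog.run_arr (c := treatNbrs) (O := valueOracle v) (b := 8) rfl σ₁)
  have bv0 := (Prog.run_var (c := treatNbrs) (O := valueOracle v) (y := 0) rfl σ₁).trans av0
  have bv1 := (Prog.run_var (c := treatNbrs) (O := valueOracle v) (y := 1) rfl σ₁).trans av1
  have bv4 := (Prog.run_var (c := treatNbrs) (O := valueOracle v) (y := 4) rfl σ₁).trans av4
  generalize treatNbrs.run (valueOracle v) σ₁ = σ₂ at *
  obtain ⟨b6, S, T, hcut, hT, hf⟩ := hspec
  have hA : allocOf n m σ₂ = allocOf n m σ := by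
    funext w
    ext e
    rw [mem_allocOf, mem_allocOf, b3]
  rw [← hA] at hun ⊢
  have hsub := fun w hw => hcut.subset (w := w) hw
  rw [Prog.wp_seq, Prog.wp_iff]
  have hkeep := allocOf_handOut (O := valueOracle v) bv0 bv1 bv4 b8 hsub hT hun
  have d6 : ∀ e : Fin m, (handOut.run (valueOracle v) σ₂).arr 6 e = 0 := fun e => by
    rw [Prog.run_arr rfl, b6]
  have d7 := Prog.run_arr (c := handOut) (O := valueOracle v) (b := 7) rfl σ₂
  have d8 := b8.congr (Prog.run_arr (c := handOut) (O := valueOracle v) (b := 8) rfl σ₂)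
  have dv1 := (Prog.run_var (c := handOut) (O := valueOracle v) (y := 1) rfl σ₂).trans bv1
  have dv4 := (Prog.run_var (c := handOut) (O := valueOracle v) (y := 4) rfl σ₂).trans bv4
  have dv15 := Prog.run_var (c := handOut) (O := valueOracle v) (y := 15) rfl σ₂
  have dv16 := Prog.run_var (c := handOut) (O := valueOracle v) (y := 16) rfl σ₂
  generalize handOut.run (valueOracle v) σ₂ = σ₃ at *
  rw [exchangeIfBetter, Prog.wp_ifLe]
  simp only [Expr.eval, Prog.wp_skip, dv16]
  rcases hf with ⟨h16, hN⟩ | ⟨f, hfN, h15, hsame, hmax⟩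
  -- Without right neighbours variable `16` keeps its initial zero, so the exchange is skipped and
  -- `keepAlloc` changes nothing.
  · refine ⟨fun h => absurd h (by omega), fun _ => ⟨d6, Or.inl ⟨hN, ?_⟩⟩⟩
    rw [hkeep]
    funext w
    unfold keepAlloc concession
    simp only [hN, Finset.biUnion_empty, Finset.union_empty, Finset.notMem_empty, if_false]
    split_ifs with hw
    · rw [hw]
    · rfl
  · have hres : ∀ A', A' = assign G c v u f S T (allocOf n m σ₂) →
        Resolves G c v u (allocOf n m σ₂) A' := fun A' h =>
      Or.inr ⟨S, T, f, hcut, hfN, hmax, h⟩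
    refine ⟨fun h1 => ?_, fun h1 => ⟨d6, hres _ ?_⟩⟩
    swap
    · rw [hkeep, assign_of_ne hcut hfN fun h => by have := hsame.2 h; omega]
    have hST := hsame.1 h1
    rw [Prog.wp_seq, Prog.wp_iff]
    have hcmp := fun e => compareBundles_spec (O := valueOracle v) dv1 e
    have e3 := Prog.run_arr (c := compareBundles) (O := valueOracle v) (b := 3) rfl σ₃
    have e6 := Prog.run_arr (c := compareBundles) (O := valueOracle v) (b := 6) rfl σ₃
    have ev1 := (Prog.run_var (c := compareBundles) (O := valueOracle v) (y := 1) rfl σ₃).trans dv1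
    have ev4 := (Prog.run_var (c := compareBundles) (O := valueOracle v) (y := 4) rfl σ₃).trans dv4
    have ev15 := (Prog.run_var (c := compareBundles) (O := valueOracle v) (y := 15) rfl σ₃).trans
      (dv15.trans h15)
    generalize compareBundles.run (valueOracle v) σ₃ = σ₄ at *
    have hA₄ : allocOf n m σ₄ = allocOf n m σ₃ := by
      funext w
      ext e
      rw [mem_allocOf, mem_allocOf, e3]
    have h9 : bundleOf m (σ₄.arr 9) = allocOf n m σ₄ u := by
      ext e
      rw [mem_bundleOf, (hcmp e).1, hA₄, mem_allocOf, dv4]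
      split_ifs <;> simp [*]
    have h10 : bundleOf m (σ₄.arr 10) = T f := by
      ext e
      rw [mem_bundleOf, (hcmp e).2, dv15, h15]
      have h8e := (d8 e).2 f
      rw [d7]
      split_ifs with h
      · exact (hT f hfN e (h8e.1 h).2).symm
      · simp only [ne_eq, not_true_eq_false, false_iff]
        exact fun he => h (h8e.2 ⟨hfN, hsub f hfN he⟩)
    rw [hkeep] at hA₄
    have hku : allocOf n m σ₄ u = allocOf n m σ₂ u ∪ concession G c u T := by
      rw [hA₄]
      simp [keepAlloc]
    have q9 : v u (bundleOf m (σ₄.arr 9)) = v u (allocOf n m σ₂ u ∪ concession G c u T) := by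
      rw [h9, hku]
    simp only [Prog.wp_seq, Prog.wp_query, Prog.wp_ifLt, Expr.eval, Mem.setVar_var,
      Mem.setVar_arr, Nat.reduceEqDiff, if_false, if_true, ev4, valueOracle_eq, q9, h10]
    refine ⟨fun hlt => ⟨fun e => ?_, hres _ ?_⟩, fun hle => ⟨fun e => ?_, hres _ ?_⟩⟩
    · rw [Prog.run_arr rfl]
      exact (congrFun e6 e).trans (d6 e)
    · rw [assign_of_dump hfN hST hlt]
      exact allocOf_exchange (by simpa [Mem.setVar_var] using ev1)
        (by simpa [Mem.setVar_var] using ev4) (by simpa [Mem.setVar_var] using ev15) hfN hsub hA₄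
        h9 h10 hun
    · exact (congrFun e6 e).trans (d6 e)
    · rw [assign_of_le hfN hST (not_lt.1 hle)]
      exact hA₄

end ResolveSpec

/-! ### Correctness of the phases and of the whole program -/

section RunSpec

variable {n m t : ℕ} {G : MultiGraph (Fin n) (Fin m)} {c : Fin n → Fin t}
  {v : Fin n → Finset (Fin m) → ℕ}

theorem ResolvesList.append_singleton {l : List (Fin n)} {u : Fin n}
    {A B A' : Fin n → Finset (Fin m)} (h : ResolvesList G c v l A B)
    (hu : Resolves G c v u B A') : ResolvesList G c v (l ++ [u]) A A' := by
  induction l generalizing A with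
  | nil =>
    obtain rfl : B = A := h
    exact ⟨A', hu, rfl⟩
  | cons x l ih =>
    obtain ⟨C, hC, h⟩ := h
    exact ⟨C, hC, ih h⟩

/-- The invariant of the abstract algorithm is needed here too: it guarantees that the edges leaving
the next vertex are unowned. -/
theorem runPhase_spec {σ : Mem} {i : ℕ} (hi : i < t) (hv : ∀ w, IsCancellable (v w))
    (h : HoldsInput G c σ) (h3 : σ.var 3 = i) (h6 : ∀ e : Fin m, σ.arr 6 e = 0)
    {Φ : Fin n → Fin n → Finset (Fin m)} {R : Fin n → Finset (Fin m)}
    (hinv : IsInvariant G c v {x | (c x : ℕ) < i} (allocOf n m σ) Φ R) :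
    runPhase.wp (valueOracle v) (fun τ => (∀ e : Fin m, τ.arr 6 e = 0) ∧
      Phase G c v i (allocOf n m σ) (allocOf n m τ)) σ := by
  have key := Prog.run_loop_induct (O := valueOracle v) (σ := σ) (prog := runPhase) rfl
    (fun k τ => (∀ e : Fin m, τ.arr 6 e = 0) ∧ ∃ l : List (Fin n), l.Nodup ∧
      (∀ x, x ∈ l ↔ (x : ℕ) < k ∧ (c x : ℕ) = i) ∧
      ResolvesList G c v l (allocOf n m σ) (allocOf n m τ))
    ⟨h6, [], List.nodup_nil, by simp, rfl⟩ ?_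
  · rw [Expr.eval, h.numVertices] at key
    obtain ⟨k6, l, hl, hmem, hres⟩ := key
    exact ⟨k6, l, hl, fun x => by rw [hmem]; simp, hres⟩
  · rintro k τ hk hvr har ⟨hI, l, hl, hmem, hres⟩
    rw [Expr.eval, h.numVertices] at hk
    have hcol := h.colours ⟨k, hk⟩
    have hin : HoldsInput G c τ := h.congr (fun x hx => by interval_cases x <;> exact hvr _ rfl)
      (fun b hb => by interval_cases b <;> exact har _ rfl)
    have h2 : τ.arr 2 = σ.arr 2 := har 2 rfl
    simp only at hcol
    rw [Prog.wp_ifEq]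
    simp only [Expr.eval, Mem.setVar_var, Mem.setVar_arr, Nat.reduceEqDiff, if_false, if_true,
      hvr 3 rfl, h3, h2, hcol]
    have hlast : ∀ x : Fin n, (x : ℕ) < k + 1 ↔ (x : ℕ) < k ∨ x = ⟨k, hk⟩ := fun x => by
      rw [Fin.ext_iff]
      exact Nat.lt_succ_iff_lt_or_eq
    refine ⟨fun hc => ?_, fun hc => ⟨hI, l, hl, fun x => ?_, hres⟩⟩
    · have hkl : (⟨k, hk⟩ : Fin n) ∉ l := fun hx => lt_irrefl _ ((hmem _).1 hx).1
      obtain ⟨Φ', R', hinv'⟩ := hres.isInvariant (i := ⟨i, hi⟩) hv hinv hl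
        (fun x hx hlt => by have := (hmem x).1 hx; have : (c x : ℕ) < i := hlt; omega)
        (fun x hx => Fin.ext ((hmem x).1 hx).2) (fun y hy => Fin.le_def.2 (le_of_lt hy))
      have hspec := resolve_spec (σ := τ.setVar 4 k) (u := ⟨k, hk⟩) hv
        (hin.congr (fun x hx => Mem.setVar_var_of_ne (by omega)) fun b _ => rfl)
        (by simp [Mem.setVar_var]) hI
        (fun z hz e he w => hinv'.unowned (by
          rintro (hx | hx)
          · have : (c ⟨k, hk⟩ : ℕ) < i := hx
            omega
          · exact hkl hx) hz he w)
      rw [Prog.wp_iff] at hspec ⊢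
      refine ⟨hspec.1, l ++ [⟨k, hk⟩], ?_, fun x => ?_, hres.append_singleton hspec.2⟩
      · rw [← List.concat_eq_append]
        exact hl.concat hkl
      · rw [List.mem_append, List.mem_singleton, hmem, hlast]
        constructor
        · rintro (h | rfl)
          · exact ⟨Or.inl h.1, h.2⟩
          · exact ⟨Or.inr rfl, hc⟩
        · rintro ⟨h | h, h'⟩
          · exact Or.inl ⟨h, h'⟩
          · exact Or.inr h
    · rw [hmem, hlast]
      refine ⟨fun h => ⟨Or.inl h.1, h.2⟩, ?_⟩
      rintro ⟨h | rfl, h'⟩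
      · exact ⟨h, h'⟩
      · exact absurd h' hc

theorem phases_spec {σ : Mem} (hv : ∀ w, IsCancellable (v w)) (h : HoldsInput G c σ)
    (h6 : ∀ e : Fin m, σ.arr 6 e = 0) (h0 : allocOf n m σ = fun _ => ∅) :
    phases.wp (valueOracle v) (fun τ => IsOutput G c v (allocOf n m τ)) σ := by
  have key := Prog.run_loop_induct (O := valueOracle v) (σ := σ) (prog := phases) rfl
    (fun k τ => (∀ e : Fin m, τ.arr 6 e = 0) ∧ ∃ B : ℕ → Fin n → Finset (Fin m),
      (B 0 = fun _ => ∅) ∧ (∀ i, i < k → Phase G c v i (B i) (B (i + 1))) ∧ B k = allocOf n m τ)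
    ⟨h6, fun _ _ => ∅, rfl, by simp, h0.symm⟩ ?_
  · simp only [Expr.eval, h.numColours] at key
    exact key.2
  · rintro k τ hk hvr har ⟨hI, B, hB0, hB, hBk⟩
    simp only [Expr.eval, h.numColours] at hk
    have hin : HoldsInput G c τ := h.congr (fun x hx => by interval_cases x <;> exact hvr _ rfl)
      (fun b hb => by interval_cases b <;> exact har _ rfl)
    obtain ⟨Φ, R, hinv⟩ := phases_isInvariant hv hB0 hk.le hB
    rw [hBk] at hinv
    have hspec := runPhase_spec (σ := τ.setVar 3 k) (i := k) (by omega) hv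
      (hin.congr (fun x hx => Mem.setVar_var_of_ne (by omega)) fun b _ => rfl)
      (by simp [Mem.setVar_var]) hI hinv
    rw [Prog.wp_iff] at hspec ⊢
    -- The recorded sequence of allocations is extended by the one now in memory.
    refine ⟨hspec.1, fun j => if j ≤ k then B j else _, ?_, fun i hik => ?_, if_neg (by omega)⟩
    · simpa using hB0
    · beta_reduce
      rcases Nat.lt_succ_iff_lt_or_eq.1 hik with hik | rfl
      · rw [if_pos hik.le, if_pos (Nat.succ_le_of_lt hik)]
        exact hB i hik
      · rw [if_pos le_rfl, if_neg (by omega), hBk]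
        exact hspec.2

theorem clearOwners_spec {O : ℕ → (ℕ → ℕ) → ℕ} {σ : Mem} (hn : σ.var 0 = n) (hm : σ.var 1 = m)
    (e : Fin m) : (clearOwners.run O σ).arr 3 e = n ∧ (clearOwners.run O σ).arr 6 e = 0 := by
  have key := Prog.run_loop_induct (O := O) (σ := σ) (prog := clearOwners) rfl
    (fun k τ => ∀ e : Fin m, (e : ℕ) < k → τ.arr 3 e = n ∧ τ.arr 6 e = 0) (by simp) ?_
  · rw [Expr.eval, hm] at key
    exact key e e.isLt
  · intro k τ hk hv ha hI
    have h0 : τ.var 0 = n := (hv 0 rfl).trans hn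
    simp only [Prog.wp_seq, Prog.wp_setArr, Expr.eval, Mem.setVar_var, Mem.setVar_arr,
      Mem.setArr_var, Mem.setArr_arr, if_true, Nat.reduceEqDiff, if_false, h0]
    intro e he
    by_cases hek : (e : ℕ) = k
    · simp [hek]
    · simpa [hek] using hI e (by omega)

theorem chromaticProg_spec {σ : Mem} (hv : ∀ w, IsCancellable (v w)) (h : HoldsInput G c σ) :
    IsOutput G c v (allocOf n m (chromaticProg.run (valueOracle v) σ)) := by
  have hclear := clearOwners_spec (O := valueOracle v) h.numVertices h.numEdges
  refine phases_spec hv (h.congr (fun x hx => ?_) fun b hb => ?_) (fun e => (hclear e).2) ?_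
  · interval_cases x <;> exact Prog.run_var rfl σ
  · interval_cases b <;> exact Prog.run_arr rfl σ
  · funext u
    ext e
    have := u.isLt
    simp only [mem_allocOf, (hclear e).1, Finset.notMem_empty, iff_false]
    omega

/-- Completeness excludes the marker `n` of an edge without owner. -/
theorem holdsOutput_allocOf {σ : Mem} (h : IsAllocation (allocOf n m σ)) :
    HoldsOutput (allocOf n m σ) σ := by
  intro e
  obtain ⟨u, hu⟩ := h.complete e
  refine ⟨u, mem_allocOf.1 hu, fun w => ?_⟩
  rw [mem_allocOf, mem_allocOf.1 hu, Fin.ext_iff, eq_comm]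

theorem numColours_le (h : G.simple.chromaticNumber = (t : ℕ∞)) : t ≤ n := by
  have := G.simple.chromaticNumber_le_card
  rw [h, Fintype.card_fin] at this
  exact_mod_cast this

end RunSpec

end ChromaticEFX

theorem mainTheorem3 :
    -- Every run of the algorithm yields a complete EFX allocation, and there is a run.
    (∀ (V : Type*) (E : Type*) [Fintype V] [Fintype E] [DecidableEq V] [DecidableEq E]
        (G : ChromaticEFX.MultiGraph V E) (t : ℕ) (c : G.simple.Coloring (Fin t))
        (v : V → Finset E → ℕ),
        G.simple.chromaticNumber = (t : ℕ∞) →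
        ((2 * t - 1 : ℕ) : ℕ∞) ≤ G.simple.egirth →
        G.Respects v →
        (∀ u, ChromaticEFX.IsCancellable (v u)) →
        (∃ A : V → Finset E, ChromaticEFX.IsOutput G c v A) ∧
        ∀ A : V → Finset E, ChromaticEFX.IsOutput G c v A →
          ChromaticEFX.IsAllocation A ∧ ChromaticEFX.IsEFX v A) ∧
    -- The algorithm is carried out by one program whose running time is polynomial.
    (∃ (prog : ChromaticEFX.Prog) (p : Polynomial ℕ),
      ∀ (n m : ℕ) (G : ChromaticEFX.MultiGraph (Fin n) (Fin m)) (t : ℕ)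
        (c : G.simple.Coloring (Fin t)) (v : Fin n → Finset (Fin m) → ℕ),
        G.simple.chromaticNumber = (t : ℕ∞) →
        ((2 * t - 1 : ℕ) : ℕ∞) ≤ G.simple.egirth →
        G.Respects v →
        (∀ u, ChromaticEFX.IsCancellable (v u)) →
        ∀ σ : ChromaticEFX.Mem, ChromaticEFX.HoldsInput G c σ →
          prog.time (ChromaticEFX.valueOracle v) σ ≤ p.eval (n + m) ∧
          ∃ A : Fin n → Finset (Fin m),
            ChromaticEFX.HoldsOutput A (prog.run (ChromaticEFX.valueOracle v) σ) ∧
            ChromaticEFX.IsOutput G c v A ∧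
            ChromaticEFX.IsAllocation A ∧ ChromaticEFX.IsEFX v A) := by
  refine ⟨?_, ?_⟩
  · intro V E _ _ _ _ G t c v _ hg hr hv
    exact ⟨ChromaticEFX.exists_isOutput G c hv, fun A hA => hA.isAllocation_isEFX hg hr hv⟩
  · obtain ⟨p, hp⟩ := ChromaticEFX.Prog.exists_time_le ChromaticEFX.isSmall_chromaticProg
    refine ⟨ChromaticEFX.chromaticProg, p, fun n m G t c v ht hg hr hv σ hσ => ⟨?_, ?_⟩⟩
    -- The loop bounds are `n`, `m` and `t`; the last is at most `n` because `t` is the chromatic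
    -- number.
    · refine hp _ σ (n + m) fun x hx => ?_
      have htn := ChromaticEFX.numColours_le ht
      have h0 := hσ.numVertices
      have h1 := hσ.numEdges
      have h2 := hσ.numColours
      interval_cases x <;> omega
    · have hout := ChromaticEFX.chromaticProg_spec (v := v) hv hσ
      have hA := hout.isAllocation_isEFX hg hr hv
      exact ⟨_, ChromaticEFX.holdsOutput_allocOf hA.1, hout, hA⟩
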